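/- Let $F$ be a nonarchimedean local field with residue cardinality $q$, a power of the prime $p$, and let $\overline F$ be an algebraic closure of $F$ and $\Gamma_F=\mathrm{Aut}(\overline F/F)$. Let $I\supset P$ be its inertia and wild inertia subgroups. Fix a lift $\sigma\in\Gamma_F$ of the arithmetic Frobenius and a topological generator $\tau$ of $I/P$, and let $\Gamma_{F,\iota}\subseteq\Gamma_F$ be the preimage of the subgroup of $\Gamma_F/P$ generated by $\sigma$ and $\tau$. Let $\widetilde F/F$ be a finite Galois extension inside $\overline F$. Let $\widehat G$ be an affine group scheme over $\mathbb Z[\frac1p]$ with an action of $\mathbb G_m\times\mathrm{Gal}(\widetilde F/F)$ by group automorphisms, put ${}^{C}G=\widehat G\rtimes(\mathbb G_m\times\mathrm{Gal}(\widetilde F/F))$, and let $d$ be the projection from ${}^CG$ to $\mathbb G_m\times\mathrm{Gal}(\widetilde F/F)$. (The main case: $\widehat G$ is the dual group of a reductive group $G$ over $F$ that splits over $\widetilde F$, with its pinned Galois action and with $\mathbb G_m$ acting through the half sum of positive coroots of $\widehat G$, viewed as a cocharacter of its adjoint group; then ${}^CG$ is the C-group of $G$.) Let $\widehat G^I\subseteq\widehat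 G$ be the subgroup scheme of points fixed by $I$. Let $\mathrm{Loc}^{\square}$ be the functor sending a $\mathbb Z[\frac1p]$-algebra $A$ to the set of homomorphisms $\rho\colon\Gamma_{F,\iota}\to{}^CG(A)$ that are trivial on an open subgroup of $P$ and satisfy $d\circ\rho=\chi$, where $\chi(\gamma)=(q^{-n},\gamma|_{\widetilde F})$ if $\gamma$ acts on the residue field of $\overline F$ as the $n$-th power of the arithmetic Frobenius. Let $\mathrm{Loc}_{{}^CG}=[\mathrm{Loc}^{\square}/\widehat G]$ (conjugation action) and $\mathrm{Loc}^{\mathrm{sph}}_{{}^CG}=[\widehat G^Iq^{-1}\sigma/\widehat G^I]$ (conjugation inside ${}^CG$), as fppf quotient stacks. Let $\Phi\colon\mathrm{Loc}^{\mathrm{sph}}_{{}^CG}\to\mathrm{Loc}_{{}^CG}$ be the morphism induced by the $\widehat G^I$-equivariant map $\widehat G^Iq^{-1}\sigma\to\mathrm{Loc}^{\square}$ that sends $x$ to the parameter $\rho_x$ with $\rho_x(\gamma)=(1,(1,\gamma|_{\widetilde F}))$ for $\gamma\in I\cap\Gamma_{F,\iota}$ and $\rho_x(\sigma)=x$; it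 sends a $\widehat G^I$-torsor $P$ with an equivariant map to $\widehat G^Iq^{-1}\sigma$ to the induced torsor $P\times^{\widehat G^I}\widehat G$ with the induced equivariant map to $\mathrm{Loc}^{\square}$. For a representation $V$ of $\widehat G$ on a finite locally free $\mathbb Z[\frac1p]$-module, let $\widetilde V$ be the pullback to $\mathrm{Loc}_{{}^CG}$ of the module on $*/\widehat G$ associated with $V$, and let $\widetilde{V|_{\widehat G^I}}$ be the pullback to $\mathrm{Loc}^{\mathrm{sph}}_{{}^CG}$ of the module on $*/\widehat G^I$ associated with $V|_{\widehat G^I}$. Then $\widetilde V$ and $\widetilde{V|_{\widehat G^I}}$ are vector bundles, and there is a canonical isomorphism $$\widetilde{V|_{\widehat G^I}}\;\cong\;\Phi^*\widetilde V$$ of vector bundles on $\mathrm{Loc}^{\mathrm{sph}}_{{}^CG}$: there is exactly one isomorphism, natural in $V$, that on an object with underlying torsor $P$ is given by $P\times^{\widehat G^I}V\to(P\times^{\widehat G^I}\widehat G)\times^{\widehat G}V$, $[p,v]\mapsto[[p,1],v]$. -/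

import Mathlib

open CategoryTheory TensorProduct ValuativeRel

universe u w w'

noncomputable section

namespace LanglandsParameters


section Stacks

variable {k : Type} [CommRing k]

/-- An fppf covering of affine `k`-schemes. -/
def IsFppf {A B : CommAlgCat.{u} k} (f : A ⟶ B) : Prop :=
  f.hom.toRingHom.FaithfullyFlat ∧ f.hom.toRingHom.FinitePresentation

/-- A presheaf of sets on affine `k`-schemes, written covariantly in the `k`-algebra. -/
structure Psh (k : Type) [CommRing k] where
  obj : CommAlgCat.{u} k → Type w
  map : ∀ {A B : CommAlgCat.{u} k}, (A ⟶ B) → obj A → obj B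
  map_id : ∀ {A : CommAlgCat.{u} k} (x : obj A), map (𝟙 A) x = x
  map_comp : ∀ {A B C : CommAlgCat.{u} k} (f : A ⟶ B) (g : B ⟶ C) (x : obj A),
    map (f ≫ g) x = map g (map f x)

/-- The gluing condition for a presheaf with respect to all fppf coverings `Spec B → Spec A`. -/
def Psh.IsSheaf (X : Psh.{u, w} k) : Prop :=
  ∀ {A B : CommAlgCat.{u} k} (f : A ⟶ B), IsFppf f → ∀ x : X.obj B,
    (∀ {C : CommAlgCat.{u} k} (u v : B ⟶ C), f ≫ u = f ≫ v → X.map u x = X.map v x) →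
    ∃! y : X.obj A, X.map f y = x

/-- The presheaf of sets underlying a presheaf of groups. -/
@[simps]
def grpPsh (G : CommAlgCat.{u} k ⥤ GrpCat.{u}) : Psh.{u, u} k where
  obj A := G.obj A
  map f := G.map f
  map_id := by simp
  map_comp := by simp

theorem isFppf_pushout {A B C : CommAlgCat.{u} k} {f : A ⟶ B} (hf : IsFppf f) (g : A ⟶ C) :
    ∃ (D : CommAlgCat.{u} k) (b : B ⟶ D) (c : C ⟶ D), f ≫ b = g ≫ c ∧ IsFppf c := by
  let _ := f.hom.toRingHom.toAlgebra
  let _ := g.hom.toRingHom.toAlgebra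
  have : IsScalarTower k A B := .of_algebraMap_eq fun x => (f.hom.commutes x).symm
  have : IsScalarTower k A C := .of_algebraMap_eq fun x => (g.hom.commutes x).symm
  have h1 : Module.FaithfullyFlat A B := hf.1
  have h2 : Algebra.FinitePresentation A B := hf.2
  refine ⟨CommAlgCat.of k (C ⊗[A] B),
    CommAlgCat.ofHom ((Algebra.TensorProduct.includeRight : B →ₐ[A] C ⊗[A] B).restrictScalars k),
    CommAlgCat.ofHom ((Algebra.TensorProduct.includeLeft : C →ₐ[A] C ⊗[A] B).restrictScalars k),
    ?_, ?_⟩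
  · ext x
    have h3 := (Algebra.TensorProduct.includeRight : B →ₐ[A] C ⊗[A] B).commutes x
    have h4 := (Algebra.TensorProduct.includeLeft : C →ₐ[A] C ⊗[A] B).commutes x
    exact h3.trans h4.symm
  · constructor
    · have : (algebraMap C (C ⊗[A] B)).FaithfullyFlat :=
        (RingHom.faithfullyFlat_algebraMap_iff).mpr inferInstance
      exact this
    · have : (algebraMap C (C ⊗[A] B)).FinitePresentation :=
        (RingHom.finitePresentation_algebraMap).mpr inferInstance
      exact this

/-- Descent of a value that is determined on a sieve containing an fppf covering. -/
theorem Psh.IsSheaf.descend {X : Psh.{u, w} k} (hX : X.IsSheaf) {B : CommAlgCat.{u} k}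
    (R : ∀ {C : CommAlgCat.{u} k}, (B ⟶ C) → X.obj C → Prop)
    (hmap : ∀ {C D : CommAlgCat.{u} k} (f : B ⟶ C) (g : C ⟶ D) (x : X.obj C),
      R f x → R (f ≫ g) (X.map g x))
    (huniq : ∀ {C : CommAlgCat.{u} k} (f : B ⟶ C) (x y : X.obj C), R f x → R f y → x = y)
    (hex : ∃ (C : CommAlgCat.{u} k) (f : B ⟶ C) (x : X.obj C), IsFppf f ∧ R f x) :
    ∃! y : X.obj B, ∀ {C : CommAlgCat.{u} k} (f : B ⟶ C) (x : X.obj C), R f x → X.map f y = x := by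
  obtain ⟨C, f, x, hf, hx⟩ := hex
  obtain ⟨y, hy, hy'⟩ := hX f hf x fun u v huv =>
    huniq (f ≫ u) _ _ (hmap f u x hx) (by rw [huv]; exact hmap f v x hx)
  refine ⟨y, fun {D} g z hz => ?_, fun y' h => hy' y' (h f x hx)⟩
  obtain ⟨E, b, c, hbc, hc⟩ := isFppf_pushout hf g
  have h1 : X.map c z = X.map c (X.map g y) := by
    rw [← X.map_comp, ← hbc, X.map_comp, hy]
    exact huniq (g ≫ c) _ _ (hmap g c z hz) (by rw [← hbc]; exact hmap f b x hx)
  exact (hX c hc (X.map c z) fun u v huv => by rw [← X.map_comp, ← X.map_comp, huv]).unique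
    h1.symm rfl

/-- `Psh.IsSheaf.descend` for a sheaf of groups. -/
theorem grp_descend {G : CommAlgCat.{u} k ⥤ GrpCat.{u}} (hG : (grpPsh G).IsSheaf)
    {B : CommAlgCat.{u} k} (R : ∀ {C : CommAlgCat.{u} k}, (B ⟶ C) → G.obj C → Prop)
    (hmap : ∀ {C D : CommAlgCat.{u} k} (f : B ⟶ C) (g : C ⟶ D) (x : G.obj C),
      R f x → R (f ≫ g) (G.map g x))
    (huniq : ∀ {C : CommAlgCat.{u} k} (f : B ⟶ C) (x y : G.obj C), R f x → R f y → x = y)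
    (hex : ∃ (C : CommAlgCat.{u} k) (f : B ⟶ C) (x : G.obj C), IsFppf f ∧ R f x) :
    ∃! y : G.obj B, ∀ {C : CommAlgCat.{u} k} (f : B ⟶ C) (x : G.obj C), R f x → G.map f y = x :=
  hG.descend R hmap huniq hex

/-- The coordinate-ring description of an affine group scheme gives an fppf sheaf. -/
theorem isSheaf_of_isCorepresentable (G : CommAlgCat.{u} k ⥤ GrpCat.{u})
    [h : (G ⋙ forget GrpCat).IsCorepresentable] : (grpPsh G).IsSheaf := by
  obtain ⟨O, ⟨e⟩⟩ := h
  intro A B f hf x hx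
  let _ := f.hom.toRingHom.toAlgebra
  have : IsScalarTower k A B := .of_algebraMap_eq fun x => (f.hom.commutes x).symm
  have h1 : Module.FaithfullyFlat A B := hf.1
  have hinj : Function.Injective f.hom := RingHom.FaithfullyFlat.injective hf.1
  have hmap : ∀ {C D : CommAlgCat.{u} k} (g : C ⟶ D) (φ : O ⟶ C),
      G.map g (e.homEquiv φ) = e.homEquiv (φ ≫ g) := fun g φ => (e.homEquiv_comp g φ).symm
  obtain ⟨φ, rfl⟩ := e.homEquiv.surjective x
  have hφ : ∀ o, ∃ a, f.hom a = φ.hom o := by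
    intro o
    have h2 := (Algebra.IsEffective.of_faithfullyFlat A B) (φ.hom o)
    refine h2.mp ?_
    rw [Algebra.TensorProduct.includeLeftSubRight_apply, sub_eq_zero]
    let l : B ⟶ CommAlgCat.of k (B ⊗[A] B) := CommAlgCat.ofHom
      ((Algebra.TensorProduct.includeLeft : B →ₐ[A] B ⊗[A] B).restrictScalars k)
    let r : B ⟶ CommAlgCat.of k (B ⊗[A] B) := CommAlgCat.ofHom
      ((Algebra.TensorProduct.includeRight : B →ₐ[A] B ⊗[A] B).restrictScalars k)
    have h3 : f ≫ l = f ≫ r := by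
      ext a
      have h3 := (Algebra.TensorProduct.includeRight : B →ₐ[A] B ⊗[A] B).commutes a
      have h4 := (Algebra.TensorProduct.includeLeft : B →ₐ[A] B ⊗[A] B).commutes a
      exact h4.trans h3.symm
    have h4 := hx l r h3
    simp only [grpPsh_map] at h4
    rw [hmap, hmap] at h4
    have h5 := e.homEquiv.injective h4
    exact congrArg (fun m => m.hom o) h5
  choose ψ hψ using hφ
  let ψ' : O →ₐ[k] A :=
    { toFun := ψ
      map_one' := hinj (by simp [hψ])
      map_mul' := fun a b => hinj (by simp [hψ])
      map_zero' := hinj (by simp [hψ])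
      map_add' := fun a b => hinj (by simp [hψ])
      commutes' := fun a => hinj (by simp [hψ]) }
  have hcomp : ∀ ψ : O ⟶ A, (∀ o, f.hom (ψ.hom o) = φ.hom o) ↔ ψ ≫ f = φ := by
    intro ψ
    constructor
    · intro h; ext o; exact h o
    · rintro rfl o; rfl
  refine ⟨e.homEquiv (CommAlgCat.ofHom ψ'), ?_, ?_⟩
  · simp only [grpPsh_map]
    rw [hmap]
    exact congrArg _ ((hcomp _).mp hψ)
  · intro y hy
    obtain ⟨χ, rfl⟩ := e.homEquiv.surjective y
    simp only [grpPsh_map] at hy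
    rw [hmap] at hy
    have h6 := (hcomp χ).mpr (e.homEquiv.injective hy)
    congr 1
    ext o
    exact hinj ((h6 o).trans (hψ o).symm)

/-- A presheaf of sets with a left action of the presheaf of groups `G`. -/
structure GSpace (G : CommAlgCat.{u} k ⥤ GrpCat.{u}) extends Psh.{u, w} k where
  smul : ∀ {A : CommAlgCat.{u} k}, G.obj A → obj A → obj A
  one_smul : ∀ {A : CommAlgCat.{u} k} (x : obj A), smul 1 x = x
  mul_smul : ∀ {A : CommAlgCat.{u} k} (g h : G.obj A) (x : obj A),
    smul (g * h) x = smul g (smul h x)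
  map_smul : ∀ {A B : CommAlgCat.{u} k} (f : A ⟶ B) (g : G.obj A) (x : obj A),
    map f (smul g x) = smul (G.map f g) (map f x)

/-- The point with the trivial action. -/
def GSpace.point (G : CommAlgCat.{u} k ⥤ GrpCat.{u}) : GSpace.{u, w} G where
  obj _ := PUnit
  map _ x := x
  map_id _ := rfl
  map_comp _ _ _ := rfl
  smul _ x := x
  one_smul _ := rfl
  mul_smul _ _ _ := rfl
  map_smul _ _ _ := rfl

/-- A right fppf `G`-torsor over `Spec A`: a sheaf on affine `A`-schemes with a simply transitive
action of `G` that has sections fppf locally. `pt b` is the set of points over `b : A ⟶ B`. (The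
gluing condition for finite disjoint unions follows from the other conditions when `G` is affine.) -/
structure Torsor (G : CommAlgCat.{u} k ⥤ GrpCat.{u}) (A : CommAlgCat.{u} k) where
  pt : ∀ {B : CommAlgCat.{u} k}, (A ⟶ B) → Type (u + 1)
  map : ∀ {B C : CommAlgCat.{u} k} {b : A ⟶ B} {c : A ⟶ C} (f : B ⟶ C), b ≫ f = c → pt b → pt c
  map_id : ∀ {B : CommAlgCat.{u} k} {b : A ⟶ B} (h : b ≫ 𝟙 B = b) (p : pt b), map (𝟙 B) h p = p
  map_comp : ∀ {B C D : CommAlgCat.{u} k} {b : A ⟶ B} {c : A ⟶ C} {d : A ⟶ D}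
    (f : B ⟶ C) (g : C ⟶ D) (hf : b ≫ f = c) (hg : c ≫ g = d) (h : b ≫ f ≫ g = d) (p : pt b),
    map (f ≫ g) h p = map g hg (map f hf p)
  act : ∀ {B : CommAlgCat.{u} k} {b : A ⟶ B}, pt b → G.obj B → pt b
  act_one : ∀ {B : CommAlgCat.{u} k} {b : A ⟶ B} (p : pt b), act p 1 = p
  act_mul : ∀ {B : CommAlgCat.{u} k} {b : A ⟶ B} (p : pt b) (g h : G.obj B),
    act p (g * h) = act (act p g) h
  map_act : ∀ {B C : CommAlgCat.{u} k} {b : A ⟶ B} {c : A ⟶ C} (f : B ⟶ C) (hf : b ≫ f = c)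
    (p : pt b) (g : G.obj B), map f hf (act p g) = act (map f hf p) (G.map f g)
  transitive : ∀ {B : CommAlgCat.{u} k} {b : A ⟶ B} (p p' : pt b), ∃! g : G.obj B, act p g = p'
  locally_nonempty : ∀ {B : CommAlgCat.{u} k} (b : A ⟶ B),
    ∃ (C : CommAlgCat.{u} k) (f : B ⟶ C), IsFppf f ∧ Nonempty (pt (b ≫ f))
  glue : ∀ {B C : CommAlgCat.{u} k} {b : A ⟶ B} {c : A ⟶ C} (f : B ⟶ C) (hf : b ≫ f = c),
    IsFppf f → ∀ p : pt c,
    (∀ {D : CommAlgCat.{u} k} {d : A ⟶ D} (u v : C ⟶ D) (hu : c ≫ u = d) (hv : c ≫ v = d),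
      f ≫ u = f ≫ v → map u hu p = map v hv p) →
    ∃! p' : pt b, map f hf p' = p

/-- An isomorphism of torsors from `P'` over `Spec A'` to the base change along `f : A ⟶ A'` of
`P` over `Spec A`. -/
structure Torsor.IsoOver {G : CommAlgCat.{u} k ⥤ GrpCat.{u}} {A A' : CommAlgCat.{u} k}
    (f : A ⟶ A') (P' : Torsor G A') (P : Torsor G A) where
  equiv : ∀ {B : CommAlgCat.{u} k} {b' : A' ⟶ B} {b : A ⟶ B}, f ≫ b' = b → P'.pt b' ≃ P.pt b
  natural : ∀ {B C : CommAlgCat.{u} k} {b' : A' ⟶ B} {b : A ⟶ B} {c' : A' ⟶ C} {c : A ⟶ C}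
    (hb : f ≫ b' = b) (hc : f ≫ c' = c) (g : B ⟶ C) (hg' : b' ≫ g = c') (hg : b ≫ g = c)
    (p : P'.pt b'), equiv hc (P'.map g hg' p) = P.map g hg (equiv hb p)
  equivariant : ∀ {B : CommAlgCat.{u} k} {b' : A' ⟶ B} {b : A ⟶ B} (hb : f ≫ b' = b)
    (p : P'.pt b') (g : G.obj B), equiv hb (P'.act p g) = P.act (equiv hb p) g

/-- An object of the quotient stack `[X/G]` over `Spec A`: a `G`-torsor `P` over `Spec A` with an
equivariant map `P ⟶ X`. -/
structure QuotStack {G : CommAlgCat.{u} k ⥤ GrpCat.{u}} (X : GSpace.{u, w} G) where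
  ring : CommAlgCat.{u} k
  torsor : Torsor G ring
  toSpace : ∀ {B : CommAlgCat.{u} k} {b : ring ⟶ B}, torsor.pt b → X.obj B
  natural : ∀ {B C : CommAlgCat.{u} k} {b : ring ⟶ B} {c : ring ⟶ C} (f : B ⟶ C)
    (hf : b ≫ f = c) (p : torsor.pt b), toSpace (torsor.map f hf p) = X.map f (toSpace p)
  equivariant : ∀ {B : CommAlgCat.{u} k} {b : ring ⟶ B} (p : torsor.pt b) (g : G.obj B),
    toSpace (torsor.act p g) = X.smul g⁻¹ (toSpace p)

namespace QuotStack

variable {G H : CommAlgCat.{u} k ⥤ GrpCat.{u}}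

/-- A morphism `x ⟶ y` of the fibred category `[X/G]`, lying over `Spec x.ring ⟶ Spec y.ring`. -/
structure Hom {X : GSpace.{u, w} G} (x y : QuotStack X) where
  base : y.ring ⟶ x.ring
  iso : Torsor.IsoOver base x.torsor y.torsor
  toSpace : ∀ {B : CommAlgCat.{u} k} {b' : x.ring ⟶ B} {b : y.ring ⟶ B} (hb : base ≫ b' = b)
    (p : x.torsor.pt b'), y.toSpace (iso.equiv hb p) = x.toSpace p

theorem Hom.ext' {X : GSpace.{u, w} G} {x y : QuotStack X} {α β : Hom x y}
    (hbase : α.base = β.base)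
    (h : ∀ {B : CommAlgCat.{u} k} {b' : x.ring ⟶ B} {b : y.ring ⟶ B} (hα : α.base ≫ b' = b)
      (hβ : β.base ≫ b' = b) (p : x.torsor.pt b'), α.iso.equiv hα p = β.iso.equiv hβ p) :
    α = β := by
  obtain ⟨f, ⟨e, he, he'⟩, hs⟩ := α
  obtain ⟨f', ⟨e', he2, he2'⟩, hs'⟩ := β
  obtain rfl : f = f' := hbase
  have : @e = @e' := by
    funext B b' b hb
    exact Equiv.ext (h hb hb)
  subst this
  rfl

/-- The identity morphism. -/
@[simps]
def Hom.id {X : GSpace.{u, w} G} (x : QuotStack X) : Hom x x where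
  base := 𝟙 _
  iso :=
    { equiv := fun {B b' b} hb =>
        { toFun := x.torsor.map (𝟙 B) (by rw [← hb, Category.id_comp, Category.comp_id])
          invFun := x.torsor.map (𝟙 B) (by rw [← hb, Category.id_comp, Category.comp_id])
          left_inv := fun p => by
            rw [Category.id_comp] at hb
            subst hb
            simp only [x.torsor.map_id]
          right_inv := fun p => by
            rw [Category.id_comp] at hb
            subst hb
            simp only [x.torsor.map_id] }
      natural := by
        intro B C b' b c' c hb hc g hg' hg p
        rw [Category.id_comp] at hb hc
        subst hb hc
        simp only [Equiv.coe_fn_mk, x.torsor.map_id]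
      equivariant := by
        intro B b' b hb p g
        rw [Category.id_comp] at hb
        subst hb
        simp only [Equiv.coe_fn_mk, x.torsor.map_id] }
  toSpace := by
    intro B b' b hb p
    rw [Category.id_comp] at hb
    subst hb
    simp only [Equiv.coe_fn_mk, x.torsor.map_id]

/-- The composition of morphisms. -/
@[simps]
def Hom.comp {X : GSpace.{u, w} G} {x y z : QuotStack X} (α : Hom x y) (β : Hom y z) :
    Hom x z where
  base := β.base ≫ α.base
  iso :=
    { equiv := fun {B b' b} hb =>
        (α.iso.equiv (b := α.base ≫ b') rfl).trans
          (β.iso.equiv (by rw [← hb, Category.assoc]))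
      natural := by
        intro B C b' b c' c hb hc g hg' hg p
        have h1 := α.iso.natural rfl rfl g hg' (by rw [Category.assoc, hg']) p
        simp only [Equiv.trans_apply, h1]
        exact β.iso.natural _ _ g _ hg _
      equivariant := by
        intro B b' b hb p g
        simp only [Equiv.trans_apply, α.iso.equivariant, β.iso.equivariant] }
  toSpace := by
    intro B b' b hb p
    simp only [Equiv.trans_apply, α.toSpace, β.toSpace]

instance {X : GSpace.{u, w} G} : Category (QuotStack X) where
  Hom := Hom
  id := Hom.id
  comp := Hom.comp
  id_comp {x y} α := by
    refine Hom.ext' (Category.comp_id _) ?_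
    intro B b' b hα hβ p
    have : ∀ (c : x.ring ⟶ B) (h : b' = c) (h' : α.base ≫ c = b) (e : b' ≫ 𝟙 B = c),
        α.iso.equiv h' (x.torsor.map (𝟙 B) e p) = α.iso.equiv hβ p := by
      intro c h h' e
      subst h
      rw [x.torsor.map_id]
    exact this (𝟙 _ ≫ b') (Category.id_comp _).symm _ _
  comp_id {x y} α := by
    refine Hom.ext' (Category.id_comp _) ?_
    intro B b' b hα hβ p
    subst hβ
    exact y.torsor.map_id _ _
  assoc {x y z t} α β γ := by
    refine Hom.ext' (Category.assoc _ _ _).symm ?_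
    intro B b' b hα hβ p
    have : ∀ {c d : z.ring ⟶ B} (q : y.torsor.pt (α.base ≫ b')) (h1 : β.base ≫ α.base ≫ b' = c)
        (h2 : β.base ≫ α.base ≫ b' = d) (h3 : γ.base ≫ c = b) (h4 : γ.base ≫ d = b),
        γ.iso.equiv h3 (β.iso.equiv h1 q) = γ.iso.equiv h4 (β.iso.equiv h2 q) := by
      intro c d q h1 h2 h3 h4
      subst h1 h2
      rfl
    exact this (c := (β.base ≫ α.base) ≫ b') (d := β.base ≫ α.base ≫ b') _
      (Category.assoc _ _ _).symm rfl (by rw [← hα]; exact (Category.assoc _ _ _).symm)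
      (by rw [← hα]; simp)

/-- The structure sheaf of `[X/G]`, sending an object over `Spec A` to `A`. -/
@[simps]
def structureSheaf {G : CommAlgCat.{u} k ⥤ GrpCat.{u}} (X : GSpace.{u, w} G) :
    (QuotStack X)ᵒᵖ ⥤ CommRingCat.{u} where
  obj x := CommRingCat.of x.unop.ring
  map α := CommRingCat.ofHom α.unop.base.hom.toRingHom
  map_id _ := rfl
  map_comp _ _ := rfl

/-- The category of presheaves of modules over the structure sheaf of `[X/G]`. It contains the
vector bundles (see `IsVectorBundle`) as a full subcategory. -/
abbrev Mod {G : CommAlgCat.{u} k ⥤ GrpCat.{u}} (X : GSpace.{u, w} G) : Type _ :=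
  PresheafOfModules.{u + 1} (structureSheaf X ⋙ forget₂ CommRingCat RingCat)

/-- The morphism of stacks `[X/G] ⟶ */G`. -/
def toBG (X : GSpace.{u, w} G) : QuotStack X ⥤ QuotStack (GSpace.point.{u, w} G) where
  obj x :=
    { ring := x.ring
      torsor := x.torsor
      toSpace := fun _ => PUnit.unit
      natural := fun _ _ _ => rfl
      equivariant := fun _ _ => rfl }
  map α :=
    { base := α.base
      iso := α.iso
      toSpace := fun _ _ => rfl }
  map_id _ := rfl
  map_comp _ _ := rfl

/-- Pullback of modules along `[X/G] ⟶ */G`: the module of sections over an object of `[X/G]` is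
the one over its image in `*/G`, which lies over the same ring. -/
def pullbackBG (X : GSpace.{u, w} G) : Mod (GSpace.point.{u, w} G) ⥤ Mod X :=
  PresheafOfModules.pushforward₀OfCommRingCat (toBG X) (structureSheaf (GSpace.point.{u, w} G))

end QuotStack

/-- The base change map `A ⊗ V ⟶ B ⊗ V` along `f : A ⟶ B`. -/
def bc (V : Type u) [AddCommGroup V] [Module k V] {A B : CommAlgCat.{u} k} (f : A ⟶ B) :
    A ⊗[k] V →ₗ[k] B ⊗[k] V :=
  LinearMap.rTensor V f.hom.toLinearMap

theorem bc_smul (V : Type u) [AddCommGroup V] [Module k V] {A B : CommAlgCat.{u} k} (f : A ⟶ B)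
    (a : A) (x : A ⊗[k] V) : bc V f (a • x) = f.hom a • bc V f x := by
  induction x with
  | zero => simp
  | tmul b v => simp [bc, smul_tmul']
  | add x y hx hy => simp [smul_add, hx, hy]

/-- A representation of `G` on a finite locally free `k`-module. -/
structure FinRep (G : CommAlgCat.{u} k ⥤ GrpCat.{u}) where
  V : Type u
  [addCommGroup : AddCommGroup V]
  [module : Module k V]
  [finite : Module.Finite k V]
  [projective : Module.Projective k V]
  ρ : ∀ A : CommAlgCat.{u} k, G.obj A →* Module.End A (A ⊗[k] V)
  natural : ∀ {A B : CommAlgCat.{u} k} (f : A ⟶ B) (g : G.obj A) (x : A ⊗[k] V),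
    bc V f (ρ A g x) = ρ B (G.map f g) (bc V f x)

namespace FinRep

attribute [instance] addCommGroup module finite projective

variable {G H : CommAlgCat.{u} k ⥤ GrpCat.{u}}

/-- A morphism of representations: a `k`-linear map that is equivariant after every base change. -/
@[ext]
structure Hom (V W : FinRep G) where
  lin : V.V →ₗ[k] W.V
  equivariant : ∀ (A : CommAlgCat.{u} k) (g : G.obj A) (x : A ⊗[k] V.V),
    lin.baseChange A (V.ρ A g x) = W.ρ A g (lin.baseChange A x)

instance : Category (FinRep G) where
  Hom := Hom
  id V := ⟨LinearMap.id, fun A g x => by simp⟩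
  comp f g := ⟨g.lin ∘ₗ f.lin, fun A a x => by
    simp only [LinearMap.baseChange_comp, LinearMap.comp_apply, f.equivariant, g.equivariant]⟩

/-- Restriction of representations along a homomorphism `H ⟶ G`. -/
def res (i : H ⟶ G) : FinRep G ⥤ FinRep H where
  obj V :=
    { V := V.V
      ρ := fun A => (V.ρ A).comp (i.app A).hom
      natural := fun {A B} f h x => by
        have h1 : G.map f ((i.app A).hom h) = (i.app B).hom (H.map f h) :=
          (NatTrans.naturality_apply i f h).symm
        have h2 := V.natural f ((i.app A).hom h) x
        rw [h1] at h2
        exact h2 }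
  map f := ⟨f.lin, fun A h x => f.equivariant A _ x⟩
  map_id _ := rfl
  map_comp _ _ := rfl

variable {A : CommAlgCat.{u} k}

/-- The sections over `Spec A` of the vector bundle `P ×^G V` associated with a `G`-torsor `P` over
`Spec A`: the equivariant maps `s : P ⟶ V`, where `s` stands for the section `[p, s(p)]`. -/
def sectionsAddSubgroup (V : FinRep G) (P : Torsor G A) :
    AddSubgroup (∀ {B : CommAlgCat.{u} k} {b : A ⟶ B}, P.pt b → B ⊗[k] V.V) where
  carrier := {s |
    (∀ {B C : CommAlgCat.{u} k} {b : A ⟶ B} {c : A ⟶ C} (f : B ⟶ C) (hf : b ≫ f = c) (p : P.pt b),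
      s (P.map f hf p) = bc V.V f (s p)) ∧
    ∀ {B : CommAlgCat.{u} k} {b : A ⟶ B} (p : P.pt b) (g : G.obj B),
      s (P.act p g) = V.ρ B g⁻¹ (s p)}
  zero_mem' := ⟨fun f hf p => by simp, fun p g => by simp⟩
  add_mem' hs ht :=
    ⟨fun f hf p => by simp [hs.1 f hf, ht.1 f hf], fun p g => by simp [hs.2, ht.2]⟩
  neg_mem' hs := ⟨fun f hf p => by simp [hs.1 f hf], fun p g => by simp [hs.2]⟩

/-- The type of sections of `P ×^G V`. -/
def Sections (V : FinRep G) (P : Torsor G A) : Type (u + 1) := V.sectionsAddSubgroup P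

namespace Sections

variable {V W : FinRep G} {P : Torsor G A}

instance : AddCommGroup (V.Sections P) :=
  inferInstanceAs (AddCommGroup (V.sectionsAddSubgroup P))

/-- The value of a section at a point of the torsor. -/
def val (s : V.Sections P) {B : CommAlgCat.{u} k} {b : A ⟶ B} (p : P.pt b) : B ⊗[k] V.V :=
  s.1 p

@[ext]
theorem ext {s t : V.Sections P}
    (h : ∀ {B : CommAlgCat.{u} k} {b : A ⟶ B} (p : P.pt b), s.val p = t.val p) : s = t :=
  Subtype.ext (by funext B b p; exact h p)

theorem val_map (s : V.Sections P) {B C : CommAlgCat.{u} k} {b : A ⟶ B} {c : A ⟶ C} (f : B ⟶ C)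
    (hf : b ≫ f = c) (p : P.pt b) : s.val (P.map f hf p) = bc V.V f (s.val p) := s.2.1 f hf p

theorem val_act (s : V.Sections P) {B : CommAlgCat.{u} k} {b : A ⟶ B} (p : P.pt b) (g : G.obj B) :
    s.val (P.act p g) = V.ρ B g⁻¹ (s.val p) := s.2.2 p g

@[simp]
theorem val_zero {B : CommAlgCat.{u} k} {b : A ⟶ B} (p : P.pt b) : (0 : V.Sections P).val p = 0 :=
  rfl

@[simp]
theorem val_add (s t : V.Sections P) {B : CommAlgCat.{u} k} {b : A ⟶ B} (p : P.pt b) :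
    (s + t).val p = s.val p + t.val p := rfl

instance : SMul A (V.Sections P) where
  smul a s := ⟨fun {B b} p => b.hom a • s.val p,
    fun {B C b c} f hf p => by
      beta_reduce
      rw [val_map, bc_smul, ← hf]
      rfl,
    fun p g => by beta_reduce; rw [val_act, map_smul]⟩

@[simp]
theorem val_smul (a : A) (s : V.Sections P) {B : CommAlgCat.{u} k} {b : A ⟶ B} (p : P.pt b) :
    (a • s).val p = b.hom a • s.val p := rfl

instance : Module A (V.Sections P) where
  one_smul s := by ext; simp
  mul_smul a b s := by ext; simp [mul_smul]
  smul_zero a := by ext; simp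
  smul_add a s t := by ext; simp
  add_smul a b s := by ext; simp [add_smul]
  zero_smul s := by ext; simp

/-- The pullback of sections along an isomorphism of `P'` with a base change of `P`. -/
def pull {A' : CommAlgCat.{u} k} {f : A ⟶ A'} {P' : Torsor G A'} (e : Torsor.IsoOver f P' P)
    (s : V.Sections P) : V.Sections P' :=
  ⟨fun {B b'} p => s.val (e.equiv (b := f ≫ b') rfl p),
    fun {B C b c} g hg p => by
      beta_reduce
      rw [e.natural rfl rfl g hg (by rw [Category.assoc, hg]), val_map],
    fun p g => by beta_reduce; rw [e.equivariant, val_act]⟩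

@[simp]
theorem val_pull {A' : CommAlgCat.{u} k} {f : A ⟶ A'} {P' : Torsor G A'}
    (e : Torsor.IsoOver f P' P) (s : V.Sections P) {B : CommAlgCat.{u} k} {b' : A' ⟶ B}
    (p : P'.pt b') : (pull e s).val p = s.val (e.equiv (b := f ≫ b') rfl p) := rfl

/-- The linear map on sections induced by a morphism of representations. -/
def pushRep (φ : V ⟶ W) : V.Sections P →ₗ[A] W.Sections P where
  toFun s := ⟨fun {B b} p => (FinRep.Hom.lin φ).baseChange B (s.val p),
    fun {B C b c} f hf p => by
      beta_reduce
      rw [val_map]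
      generalize s.val p = x
      induction x with
      | zero => simp
      | tmul a v => simp [bc]
      | add x y hx hy => simp only [map_add, hx, hy],
    fun p g => by beta_reduce; rw [val_act]; exact FinRep.Hom.equivariant φ _ _ _⟩
  map_add' s t := by ext B b p; exact map_add _ _ _
  map_smul' a s := by ext B b p; exact map_smul _ _ _

@[simp]
theorem val_pushRep (φ : V ⟶ W) (s : V.Sections P) {B : CommAlgCat.{u} k} {b : A ⟶ B}
    (p : P.pt b) : (pushRep φ s).val p = (FinRep.Hom.lin φ).baseChange B (s.val p) := rfl

end Sections

theorem Sections.val_congr {V : FinRep G} {P : Torsor G A} (s : V.Sections P)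
    {B : CommAlgCat.{u} k} {b c : A ⟶ B} (h : b ≫ 𝟙 B = c) (p : P.pt b) :
    s.val (P.map (𝟙 B) h p) = s.val p := by
  obtain rfl : b = c := by rw [← h, Category.comp_id]
  rw [P.map_id]

/-- The presheaf of abelian groups underlying the vector bundle on `*/G` defined by `V`. -/
def abOnBG (V : FinRep G) : (QuotStack (GSpace.point.{u, w} G))ᵒᵖ ⥤ Ab.{u + 1} where
  obj x := AddCommGrpCat.of (V.Sections x.unop.torsor)
  map α := AddCommGrpCat.ofHom
    { toFun := Sections.pull (QuotStack.Hom.iso α.unop)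
      map_zero' := rfl
      map_add' := fun _ _ => rfl }
  map_id x := by
    ext s B b p
    exact Sections.val_congr (P := x.unop.torsor) s _ p
  map_comp {x y z} α β := by
    ext s B b p
    have key : ∀ {c d : x.unop.ring ⟶ B} (q : y.unop.torsor.pt (QuotStack.Hom.base β.unop ≫ b))
        (hc : QuotStack.Hom.base α.unop ≫ QuotStack.Hom.base β.unop ≫ b = c)
        (hd : QuotStack.Hom.base α.unop ≫ QuotStack.Hom.base β.unop ≫ b = d),
        s.val ((QuotStack.Hom.iso α.unop).equiv hc q) =
          s.val ((QuotStack.Hom.iso α.unop).equiv hd q) := by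
      intro c d q hc hd
      subst hc hd
      rfl
    exact key _ _ _

instance (V : FinRep G) (x : (QuotStack (GSpace.point.{u, w} G))ᵒᵖ) :
    Module ((QuotStack.structureSheaf (GSpace.point.{u, w} G) ⋙
      forget₂ CommRingCat RingCat).obj x) (V.abOnBG.obj x) :=
  inferInstanceAs (Module x.unop.ring (V.Sections x.unop.torsor))

/-- The functor sending a representation `V` of `G` to the associated vector bundle on `*/G`. -/
def onBG (G : CommAlgCat.{u} k ⥤ GrpCat.{u}) : FinRep G ⥤ QuotStack.Mod (GSpace.point.{u, w} G) where
  obj V := PresheafOfModules.ofPresheaf V.abOnBG fun x y α r m => by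
    refine Sections.ext fun {B b} p => ?_
    rfl
  map {V W} φ := PresheafOfModules.homMk
    { app := fun x => AddCommGrpCat.ofHom
        (Sections.pushRep (P := x.unop.torsor) φ).toAddMonoidHom
      naturality := fun x y α => by
        ext s
        refine Sections.ext fun {B b} p => ?_
        rfl }
    fun x r m => map_smul (Sections.pushRep (P := x.unop.torsor) φ) _ _
  map_id V := by
    ext x s
    refine Sections.ext fun {B b} p => ?_
    change LinearMap.baseChange B LinearMap.id (Sections.val s p) = Sections.val s p
    simp
  map_comp {U V W} φ ψ := by
    ext x s
    refine Sections.ext fun {B b} p => ?_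
    change LinearMap.baseChange B ((Hom.lin ψ) ∘ₗ (Hom.lin φ)) (Sections.val s p) = _
    rw [LinearMap.baseChange_comp]
    rfl

/-- The functor `V ↦ Ṽ`, the pullback along `[X/G] ⟶ */G` of the vector bundle defined by `V`. -/
def tilde (X : GSpace.{u, w} G) : FinRep G ⥤ QuotStack.Mod X :=
  onBG G ⋙ QuotStack.pullbackBG X

end FinRep

/-- A module over the structure sheaf of `[X/G]` is a vector bundle if all its modules of sections
are finite locally free and are compatible with base change. -/
def IsVectorBundle {G : CommAlgCat.{u} k ⥤ GrpCat.{u}} {X : GSpace.{u, w} G}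
    (M : QuotStack.Mod X) : Prop :=
  (∀ x, Module.Finite ((QuotStack.structureSheaf X).obj x) (M.obj x)) ∧
  (∀ x, Module.Projective ((QuotStack.structureSheaf X).obj x) (M.obj x)) ∧
  ∀ {x y : (QuotStack X)ᵒᵖ} (α : x ⟶ y),
    letI : Algebra ((QuotStack.structureSheaf X).obj x) ((QuotStack.structureSheaf X).obj y) :=
      ((QuotStack.structureSheaf X).map α).hom.toAlgebra
    letI : Module ((QuotStack.structureSheaf X).obj x) (M.obj y) :=
      Module.compHom (M.obj y) ((QuotStack.structureSheaf X).map α).hom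
    haveI : IsScalarTower ((QuotStack.structureSheaf X).obj x)
      ((QuotStack.structureSheaf X).obj y) (M.obj y) := ⟨fun _ b m => mul_smul _ b m⟩
    IsBaseChange ((QuotStack.structureSheaf X).obj y)
      ({ toFun := fun m => M.map α m
         map_add' := fun m n => map_add (M.map α).hom m n
         map_smul' := fun a m => M.map_smul α a m } :
        M.obj x →ₗ[(QuotStack.structureSheaf X).obj x] M.obj y)

section Induction

variable {G H : CommAlgCat.{u} k ⥤ GrpCat.{u}} {A : CommAlgCat.{u} k}

theorem Torsor.act_injective (P : Torsor H A) {B : CommAlgCat.{u} k} {b : A ⟶ B} (p : P.pt b)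
    {g h : H.obj B} (e : P.act p g = P.act p h) : g = h :=
  (P.transitive p (P.act p h)).unique e rfl

/-- The unique `h` with `p' = p h`. -/
def Torsor.diff (P : Torsor H A) {B : CommAlgCat.{u} k} {b : A ⟶ B} (p p' : P.pt b) : H.obj B :=
  (P.transitive p p').choose

theorem Torsor.act_diff (P : Torsor H A) {B : CommAlgCat.{u} k} {b : A ⟶ B} (p p' : P.pt b) :
    P.act p (P.diff p p') = p' :=
  (P.transitive p p').choose_spec.1

/-- The points over `b : A ⟶ B` of the torsor `P ×^H G` induced from an `H`-torsor `P` along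
`i : H ⟶ G`: the maps `s : P ⟶ G` over `B` with `s(p h) = i(h)⁻¹ s(p)`, where `s` stands for the
point `[p, s(p)]`. -/
@[ext]
structure IndPt (i : H ⟶ G) (P : Torsor H A) {B : CommAlgCat.{u} k} (b : A ⟶ B) where
  val : ∀ {C : CommAlgCat.{u} k} {c : A ⟶ C} (f : B ⟶ C), b ≫ f = c → P.pt c → G.obj C
  natural : ∀ {C D : CommAlgCat.{u} k} {c : A ⟶ C} {d : A ⟶ D} (f : B ⟶ C) (g : C ⟶ D)
    (hc : b ≫ f = c) (hg : c ≫ g = d) (hd : b ≫ f ≫ g = d) (p : P.pt c),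
    val (f ≫ g) hd (P.map g hg p) = G.map g (val f hc p)
  equivariant : ∀ {C : CommAlgCat.{u} k} {c : A ⟶ C} (f : B ⟶ C) (hc : b ≫ f = c) (p : P.pt c)
    (h : H.obj C), val f hc (P.act p h) = (i.app C h)⁻¹ * val f hc p

namespace IndPt

variable {i : H ⟶ G} {P : Torsor H A}

theorem ext' {B : CommAlgCat.{u} k} {b : A ⟶ B} {s t : IndPt i P b}
    (h : ∀ {C : CommAlgCat.{u} k} {c : A ⟶ C} (f : B ⟶ C) (hc : b ≫ f = c) (p : P.pt c),
      s.val f hc p = t.val f hc p) : s = t := by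
  apply IndPt.ext
  funext C c f hc p
  exact h f hc p

/-- The image of a point under base change. -/
@[simps]
def map {B C : CommAlgCat.{u} k} {b : A ⟶ B} {c : A ⟶ C} (f : B ⟶ C) (hf : b ≫ f = c)
    (s : IndPt i P b) : IndPt i P c where
  val g hd p := s.val (f ≫ g) (by rw [← hd, ← hf, Category.assoc]) p
  natural g g' hd hg hd' p := by
    have h1 := s.natural (f ≫ g) g' (by rw [← hd, ← hf, Category.assoc]) hg
      (by rw [← hd', ← hf]; simp) p
    rw [← h1]
    congr 1
  equivariant g hd p h := s.equivariant _ _ p h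

/-- The right action of `G`. -/
@[simps]
def act {B : CommAlgCat.{u} k} {b : A ⟶ B} (s : IndPt i P b) (g : G.obj B) : IndPt i P b where
  val f hc p := s.val f hc p * G.map f g
  natural f f' hc hg hd p := by rw [s.natural f f' hc hg hd p]; simp
  equivariant f hc p h := by rw [s.equivariant, mul_assoc]

/-- The point `[p, 1]` of `P ×^H G`. -/
def ofPt {B : CommAlgCat.{u} k} {b : A ⟶ B} (p : P.pt b) : IndPt i P b where
  val f hc p' := (i.app _ (P.diff (P.map f hc p) p'))⁻¹
  natural := by
    intro C D c d f g hc hg hd p'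
    have h1 : P.diff (P.map (f ≫ g) hd p) (P.map g hg p') =
        H.map g (P.diff (P.map f hc p) p') := by
      apply P.act_injective (P.map (f ≫ g) hd p)
      rw [P.act_diff, P.map_comp f g hc hg hd, ← P.map_act, P.act_diff]
    rw [h1, map_inv, NatTrans.naturality_apply]
  equivariant := by
    intro C c f hc p' h
    have h1 : P.diff (P.map f hc p) (P.act p' h) = P.diff (P.map f hc p) p' * h := by
      apply P.act_injective (P.map f hc p)
      rw [P.act_diff, P.act_mul, P.act_diff]
    rw [h1, map_mul, mul_inv_rev]

end IndPt

/-- The `G`-torsor `P ×^H G` induced from an `H`-torsor `P` along `i : H ⟶ G`. -/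
def Torsor.induce (i : H ⟶ G) (hG : (grpPsh G).IsSheaf) (P : Torsor H A) : Torsor G A where
  pt b := IndPt i P b
  map := IndPt.map
  map_id h s := IndPt.ext' fun f hc p => by simp [Category.id_comp]
  map_comp f g hf hg h s := IndPt.ext' fun f' hc p => by simp [Category.assoc]
  act := IndPt.act
  act_one s := IndPt.ext' fun f hc p => by simp
  act_mul s g h := IndPt.ext' fun f hc p => by simp [mul_assoc]
  map_act f hf s g := IndPt.ext' fun f' hc p => by simp
  transitive {B b} s t := by
    have key := grp_descend hG (B := B)
      (fun {C} f x => ∃ p : P.pt (b ≫ f), x = (s.val f rfl p)⁻¹ * t.val f rfl p)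
      (by
        rintro C D f g x ⟨p, rfl⟩
        refine ⟨P.map g (Category.assoc _ _ _) p, ?_⟩
        rw [s.natural f g rfl _ _ p, t.natural f g rfl _ _ p]
        simp)
      (by
        rintro C f x y ⟨p, rfl⟩ ⟨p', rfl⟩
        rw [← P.act_diff p p', s.equivariant, t.equivariant]
        simp)
      (by
        obtain ⟨C, f, hf, ⟨p⟩⟩ := P.locally_nonempty b
        exact ⟨C, f, _, hf, p, rfl⟩)
    obtain ⟨g, hg, hg'⟩ := key
    refine ⟨g, IndPt.ext' fun {C c} f hc p => ?_, fun g' h => hg' g' fun {C} f x hx => ?_⟩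
    · subst hc
      have := hg f _ ⟨p, rfl⟩
      simp [this]
    · obtain ⟨p, rfl⟩ := hx
      rw [← h]
      simp
  locally_nonempty {B} b := by
    obtain ⟨C, f, hf, ⟨p⟩⟩ := P.locally_nonempty b
    exact ⟨C, f, hf, ⟨IndPt.ofPt p⟩⟩
  glue {B C b c} f hf hff s hs := by
    have hval : ∀ {D : CommAlgCat.{u} k} {d : A ⟶ D} (g : B ⟶ D) (hd : b ≫ g = d) (p : P.pt d),
        ∃! x : G.obj D, ∀ {E : CommAlgCat.{u} k} {d' : A ⟶ E} (e : D ⟶ E) (c' : C ⟶ E)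
          (_ : f ≫ c' = g ≫ e) (h : d ≫ e = d') (h' : c ≫ c' = d'),
          G.map e x = s.val c' h' (P.map e h p) := by
      intro D d g hd p
      have key := grp_descend hG (B := D)
        (fun {E} e x => ∃ (c' : C ⟶ E) (_ : f ≫ c' = g ≫ e) (h' : c ≫ c' = d ≫ e),
          x = s.val c' h' (P.map e rfl p))
        (by
          rintro E E' e e' _ ⟨c', h, h', rfl⟩
          have h2 : c ≫ c' ≫ e' = d ≫ e ≫ e' := by
            rw [← Category.assoc, h', Category.assoc]
          refine ⟨c' ≫ e', by rw [← Category.assoc, h, Category.assoc], h2, ?_⟩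
          have h1 := s.natural c' e' h' (Category.assoc _ _ _) h2 (P.map e rfl p)
          rw [P.map_comp e e' rfl (Category.assoc _ _ _) rfl]
          exact h1.symm)
        (by
          rintro E e _ _ ⟨c₁, h₁, h₁', rfl⟩ ⟨c₂, h₂, h₂', rfl⟩
          have h1 := hs c₁ c₂ h₁' h₂' (h₁.trans h₂.symm)
          have h2 := congrArg (fun t : IndPt i P (d ≫ e) =>
            t.val (𝟙 E) (Category.comp_id _) (P.map e rfl p)) h1
          simpa using h2)
        (by
          obtain ⟨E, c', e, h, he⟩ := isFppf_pushout hff g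
          exact ⟨E, e, _, he, c', h, by rw [← hf, ← hd, Category.assoc, h, Category.assoc], rfl⟩)
      obtain ⟨x, hx, hx'⟩ := key
      refine ⟨x, fun {E d'} e c' h hd' h' => ?_, fun y hy => hx' y ?_⟩
      · subst hd'
        exact hx e _ ⟨c', h, h', rfl⟩
      · rintro E e _ ⟨c', h, h', rfl⟩
        exact hy e c' h rfl h'
    refine ⟨⟨fun {D d} g hd p => (hval g hd p).choose, ?_, ?_⟩, ?_, ?_⟩
    · intro D D' d d' g g' hd hg' hd' p
      refine ((hval (g ≫ g') hd' (P.map g' hg' p)).choose_spec.2 _ ?_).symm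
      intro E d'' e c' h h1 h2
      have h3 := (hval g hd p).choose_spec.1 (g' ≫ e) c' (by rw [h, Category.assoc])
        (by rw [← Category.assoc, hg', h1]) h2
      rw [P.map_comp g' e hg' h1] at h3
      rw [← h3]
      simp
    · intro D d g hd p h
      refine ((hval g hd (P.act p h)).choose_spec.2 _ ?_).symm
      intro E d'' e c' h0 h1 h2
      have h3 := (hval g hd p).choose_spec.1 e c' h0 h1 h2
      rw [P.map_act, s.equivariant, ← h3, map_mul, map_inv, NatTrans.naturality_apply]
    · refine IndPt.ext' fun {D d} g hd p => ?_
      have h3 := (hval (f ≫ g) (by rw [← hd, ← hf, Category.assoc]) p).choose_spec.1 (𝟙 D) g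
        (Category.comp_id _).symm (Category.comp_id _) hd
      rw [P.map_id] at h3
      simpa using h3
    · intro t ht
      refine IndPt.ext' fun {D d} g hd p => ?_
      refine (hval g hd p).choose_spec.2 _ ?_
      intro E d' e c' h h1 h2
      rw [← t.natural g e hd h1 (by rw [← h1, ← hd, Category.assoc]) p]
      have h4 := congrArg (fun t : IndPt i P c => t.val c' h2 (P.map e h1 p)) ht
      rw [← h4]
      simp [h]

/-- The map `P ⟶ P ×^H G`, `p ↦ [p, 1]`. -/
def Torsor.toInduce (i : H ⟶ G) (hG : (grpPsh G).IsSheaf) (P : Torsor H A)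
    {B : CommAlgCat.{u} k} {b : A ⟶ B} (p : P.pt b) : (P.induce i hG).pt b :=
  IndPt.ofPt p

theorem Torsor.IsoOver.symm_map {A' : CommAlgCat.{u} k} {f : A ⟶ A'} {P' : Torsor H A'}
    {P : Torsor H A} (e : Torsor.IsoOver f P' P) {B C : CommAlgCat.{u} k} {b' : A' ⟶ B}
    {b : A ⟶ B} {c' : A' ⟶ C} {c : A ⟶ C} (hb : f ≫ b' = b) (hc : f ≫ c' = c) (g : B ⟶ C)
    (hg' : b' ≫ g = c') (hg : b ≫ g = c) (p : P.pt b) :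
    (e.equiv hc).symm (P.map g hg p) = P'.map g hg' ((e.equiv hb).symm p) := by
  rw [Equiv.symm_apply_eq, e.natural hb hc g hg' hg, Equiv.apply_symm_apply]

theorem Torsor.IsoOver.symm_act {A' : CommAlgCat.{u} k} {f : A ⟶ A'} {P' : Torsor H A'}
    {P : Torsor H A} (e : Torsor.IsoOver f P' P) {B : CommAlgCat.{u} k} {b' : A' ⟶ B}
    {b : A ⟶ B} (hb : f ≫ b' = b) (p : P.pt b) (h : H.obj B) :
    (e.equiv hb).symm (P.act p h) = P'.act ((e.equiv hb).symm p) h := by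
  rw [Equiv.symm_apply_eq, e.equivariant hb, Equiv.apply_symm_apply]

/-- The isomorphism of induced torsors defined by an isomorphism of torsors. -/
def Torsor.IsoOver.induce (i : H ⟶ G) (hG : (grpPsh G).IsSheaf) {A' : CommAlgCat.{u} k}
    {f : A ⟶ A'} {P' : Torsor H A'} {P : Torsor H A} (e : Torsor.IsoOver f P' P) :
    Torsor.IsoOver f (P'.induce i hG) (P.induce i hG) where
  equiv {B b' b} hb :=
    { toFun := fun (s : IndPt i P' b') =>
        ({ val := fun {C c} g hc p => s.val g rfl ((e.equiv (b' := b' ≫ g)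
            (by rw [← hc, ← hb, Category.assoc])).symm p)
           natural := by
            intro C D c d g g' hc hg hd p
            rw [e.symm_map (b' := b' ≫ g) (by rw [← hc, ← hb, Category.assoc]) _ g'
              (Category.assoc _ _ _) hg, s.natural g g' rfl]
           equivariant := by
            intro C c g hc p h
            rw [e.symm_act, s.equivariant] } : IndPt i P b)
      invFun := fun (s : IndPt i P b) =>
        ({ val := fun {C c} g hc p => s.val g (by rw [← hc, ← hb, Category.assoc])
            (e.equiv (b := f ≫ c) rfl p)
           natural := by
            intro C D c d g g' hc hg hd p
            rw [e.natural rfl rfl g' hg (by rw [Category.assoc, hg]), s.natural g g']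
           equivariant := by
            intro C c g hc p h
            rw [e.equivariant, s.equivariant] } : IndPt i P' b')
      left_inv := fun s => IndPt.ext' fun g hc p => by
        subst hc
        simp
      right_inv := fun s => IndPt.ext' fun {C c} g hc p => by
        have : ∀ {c' : A ⟶ C} (h1 : f ≫ b' ≫ g = c') (h2 : b ≫ g = c') (h3 : f ≫ b' ≫ g = c),
            s.val g h2 (e.equiv h1 ((e.equiv h3).symm p)) = s.val g hc p := by
          intro c' h1 h2 h3
          obtain rfl : c = c' := h3.symm.trans h1
          rw [Equiv.apply_symm_apply]
        exact this _ _ _ }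
  natural := by
    intro B C b' b c' c hb hc g hg' hg s
    refine IndPt.ext' fun {D d} g' hd p => ?_
    have : ∀ {d' d'' : A' ⟶ D} (h : d' = d'') (h1 : b' ≫ g ≫ g' = d') (h1' : b' ≫ g ≫ g' = d'')
        (h2 : f ≫ d' = d) (h2' : f ≫ d'' = d),
        IndPt.val s (g ≫ g') h1 ((e.equiv h2).symm p) =
          IndPt.val s (g ≫ g') h1' ((e.equiv h2').symm p) := by
      intro d' d'' h h1 h1' h2 h2'
      subst h
      rfl
    exact this (by rw [← hg', Category.assoc]) _ _ _ _
  equivariant := by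
    intro B b' b hb s g
    exact IndPt.ext' fun {D d} g' hd p => rfl

/-- A map `X ⟶ Y` of spaces that is equivariant along `i : H ⟶ G`. -/
structure GSpace.MapAlong (i : H ⟶ G) (X : GSpace.{u, w} H) (Y : GSpace.{u, w'} G) where
  app : ∀ {A : CommAlgCat.{u} k}, X.obj A → Y.obj A
  natural : ∀ {A B : CommAlgCat.{u} k} (f : A ⟶ B) (x : X.obj A), app (X.map f x) = Y.map f (app x)
  equivariant : ∀ {A : CommAlgCat.{u} k} (h : H.obj A) (x : X.obj A),
    app (X.smul h x) = Y.smul (i.app A h) (app x)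

/-- The point `g⁻¹ • ψ(φ(p))` of `Y` attached to the point `[p, g]` of `P ×^H G`, where
`φ : P ⟶ X` is the given equivariant map. -/
theorem GSpace.MapAlong.existsUnique_toSpace {i : H ⟶ G} {X : GSpace.{u, w} H}
    {Y : GSpace.{u, w'} G} (ψ : GSpace.MapAlong i X Y) (hY : Y.toPsh.IsSheaf) (x : QuotStack X)
    {B : CommAlgCat.{u} k} {b : x.ring ⟶ B} (s : IndPt i x.torsor b) :
    ∃! y : Y.obj B, ∀ {C : CommAlgCat.{u} k} {c : x.ring ⟶ C} (f : B ⟶ C) (hc : b ≫ f = c)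
      (p : x.torsor.pt c), Y.map f y = Y.smul (s.val f hc p)⁻¹ (ψ.app (x.toSpace p)) := by
  have key := hY.descend (B := B)
    (fun {C} f y => ∃ p : x.torsor.pt (b ≫ f),
      y = Y.smul (s.val f rfl p)⁻¹ (ψ.app (x.toSpace p)))
    (by
      rintro C D f g _ ⟨p, rfl⟩
      refine ⟨x.torsor.map g (Category.assoc _ _ _) p, ?_⟩
      rw [s.natural f g rfl _ _ p, x.natural, ψ.natural, Y.map_smul, map_inv])
    (by
      rintro C f _ _ ⟨p, rfl⟩ ⟨p', rfl⟩
      rw [← x.torsor.act_diff p p', s.equivariant, x.equivariant, ψ.equivariant, ← Y.mul_smul]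
      simp)
    (by
      obtain ⟨C, f, hf, ⟨p⟩⟩ := x.torsor.locally_nonempty b
      exact ⟨C, f, _, hf, p, rfl⟩)
  obtain ⟨y, hy, hy'⟩ := key
  refine ⟨y, fun {C c} f hc p => ?_, fun z hz => hy' z ?_⟩
  · subst hc
    exact hy f _ ⟨p, rfl⟩
  · rintro C f _ ⟨p, rfl⟩
    exact hz f rfl p

namespace QuotStack

variable (i : H ⟶ G) (hG : (grpPsh G).IsSheaf) {X : GSpace.{u, w} H}
  {Y : GSpace.{u, w'} G} (ψ : GSpace.MapAlong i X Y) (hY : Y.toPsh.IsSheaf)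

/-- The object of `[Y/G]` attached to an object `(P, φ : P ⟶ X)` of `[X/H]`: the induced torsor
`P ×^H G` with the equivariant map `[p, g] ↦ g⁻¹ • ψ(φ(p))`. -/
def mapAlongObj (x : QuotStack X) : QuotStack Y where
  ring := x.ring
  torsor := x.torsor.induce i hG
  toSpace := fun s => (ψ.existsUnique_toSpace hY x s).choose
  natural := fun {B C b c} f hf s => by
    refine ((ψ.existsUnique_toSpace hY x _).choose_spec.2 _ ?_).symm
    intro D d g hd p
    rw [← Y.map_comp]
    exact (ψ.existsUnique_toSpace hY x s).choose_spec.1 (f ≫ g) _ p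
  equivariant := fun {B b} s g => by
    refine ((ψ.existsUnique_toSpace hY x _).choose_spec.2 _ ?_).symm
    intro D d f hd p
    rw [Y.map_smul, (ψ.existsUnique_toSpace hY x s).choose_spec.1 f hd p, ← Y.mul_smul,
      map_inv, ← mul_inv_rev]
    rfl

/-- The action of `mapAlongObj` on morphisms. -/
def mapAlongHom {x y : QuotStack X} (α : Hom x y) :
    Hom (mapAlongObj i hG ψ hY x) (mapAlongObj i hG ψ hY y) where
  base := α.base
  iso := α.iso.induce i hG
  toSpace := fun {B b' b} hb s => by
    refine (ψ.existsUnique_toSpace hY x s).choose_spec.2 _ ?_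
    intro C c f hc p
    have h1 := (ψ.existsUnique_toSpace hY y
      ((α.iso.induce i hG).equiv hb s)).choose_spec.1 f
      (by rw [← hb]; exact (Category.assoc _ _ _).trans (congrArg _ hc)) (α.iso.equiv (b := α.base ≫ c) rfl p)
    rw [α.toSpace] at h1
    refine h1.trans ?_
    subst hc
    congr 2
    exact congrArg (IndPt.val s f rfl) (Equiv.symm_apply_apply _ _)

/-- The morphism of quotient stacks `[X/H] ⟶ [Y/G]` defined by a map `ψ : X ⟶ Y` that is
equivariant along `i : H ⟶ G`. -/
def mapAlong : QuotStack X ⥤ QuotStack Y where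
  obj := mapAlongObj i hG ψ hY
  map := mapAlongHom i hG ψ hY
  map_id x := by
    refine Hom.ext' rfl ?_
    intro B b' b hα hβ s
    obtain rfl : b' = b := by rw [← hβ]; exact (Category.id_comp _).symm
    refine IndPt.ext' fun {C c} f hc p => ?_
    subst hc
    have h1 := IndPt.natural s f (𝟙 C) rfl (Category.comp_id _) (by simp) p
    change IndPt.val s f rfl (x.torsor.map (𝟙 C) (Category.comp_id _) p) =
      IndPt.val s (𝟙 B ≫ f) _ p
    rw [x.torsor.map_id]
    congr 1
  map_comp {x y z} α β := by
    refine Hom.ext' rfl ?_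
    intro B b' b hα hβ s
    refine IndPt.ext' fun {C c} f hc p => ?_
    have : ∀ {d d' : y.ring ⟶ C} (h : d = d') (h1 : Hom.base α ≫ (b' : x.ring ⟶ B) ≫ f = d)
        (h1' : Hom.base α ≫ (b' : x.ring ⟶ B) ≫ f = d') (h2 : Hom.base β ≫ d = c)
        (h2' : Hom.base β ≫ d' = c),
        IndPt.val s f rfl (((Hom.iso α).equiv h1).symm (((Hom.iso β).equiv h2).symm p)) =
          IndPt.val s f rfl (((Hom.iso α).equiv h1').symm (((Hom.iso β).equiv h2').symm p)) := by
      intro d d' h h1 h1' h2 h2'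
      subst h
      rfl
    have h1 : Hom.base α ≫ (b' : x.ring ⟶ B) ≫ f = (Hom.base α ≫ b') ≫ f :=
      (Category.assoc _ _ _).symm
    have h2 : Hom.base β ≫ Hom.base α ≫ (b' : x.ring ⟶ B) ≫ f = c := by
      rw [← hc, ← hα]
      exact ((Category.assoc _ _ _).trans (Category.assoc _ _ _)).symm
    exact this h1 rfl h1 h2 (h1 ▸ h2)

/-- Pullback of modules along `[X/H] ⟶ [Y/G]`. -/
def pullbackAlong : Mod Y ⥤ Mod X :=
  PresheafOfModules.pushforward₀OfCommRingCat (mapAlong i hG ψ hY) (structureSheaf Y)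

end QuotStack

end Induction

end Stacks
section Galois

variable (F : Type*) [Field F] [ValuativeRel F] [TopologicalSpace F]
  [IsNonarchimedeanLocalField F]

/-- The absolute Galois group `Γ_F = Aut(F̄/F)`, with its Krull topology. -/
abbrev AbsGal : Type _ := AlgebraicClosure F ≃ₐ[F] AlgebraicClosure F

/-- The ring of integers of `F̄`. -/
abbrev IntBar : Type _ := integralClosure 𝒪[F] (AlgebraicClosure F)

/-- The maximal ideal of the (local) ring of integers of `F̄`, as its Jacobson radical. -/
def maxBar : Ideal (IntBar F) := Ideal.jacobson ⊥

/-- The residue cardinality `q`. -/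
def resCard : ℕ := Nat.card 𝓀[F]

/-- The residue characteristic `p`. -/
def resChar : ℕ := ringChar 𝓀[F]

/-- The base ring `ℤ[1/p]`. -/
abbrev BaseRing : Type := Localization.Away ((resChar F : ℕ) : ℤ)

theorem isUnit_resCard : IsUnit ((resCard F : ℕ) : BaseRing F) := by
  have : Fintype 𝓀[F] := Fintype.ofFinite _
  obtain ⟨n, -, hn⟩ := FiniteField.card 𝓀[F] (ringChar 𝓀[F])
  have h : resCard F = resChar F ^ (n : ℕ) := by
    rw [resCard, Nat.card_eq_fintype_card, hn]; rfl
  rw [h, Nat.cast_pow]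
  refine IsUnit.pow _ ?_
  have := IsLocalization.Away.algebraMap_isUnit (S := BaseRing F) ((resChar F : ℕ) : ℤ)
  simpa using this

/-- The unit `q` of `ℤ[1/p]`. -/
def qUnit : (BaseRing F)ˣ := (isUnit_resCard F).unit

theorem smul_mem_maxBar {F : Type*} [Field F] [ValuativeRel F] (γ : AbsGal F) {x : IntBar F} (hx : x ∈ maxBar F) :
    γ • x ∈ maxBar F := by
  rw [maxBar, Ideal.mem_jacobson_bot] at hx ⊢
  intro y
  have h := (hx (γ⁻¹ • y)).map (MulSemiringAction.toRingHom (AbsGal F) (IntBar F) γ)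
  simpa using h

/-- The inertia subgroup `I_F`: the automorphisms acting trivially on the residue field. -/
def inertia : Subgroup (AbsGal F) :=
  (maxBar F).toAddSubgroup.inertia (AbsGal F)

instance : (inertia F).Normal where
  conj_mem i hi γ x := by
    have h := smul_mem_maxBar γ (hi (γ⁻¹ • x))
    simpa [mul_smul, smul_sub] using h

/-- The wild inertia subgroup `P_F`: the `γ` with `γ(x)/x ≡ 1` modulo the maximal ideal for all
nonzero `x` in `F̄`. -/
def wildInertia : Subgroup (AbsGal F) where
  carrier := {γ | ∀ x : AlgebraicClosure F, x ≠ 0 → ∃ a ∈ maxBar F, γ x = (1 + a) * x}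
  one_mem' x _ := ⟨0, zero_mem _, by simp⟩
  mul_mem' {γ δ} hγ hδ x hx := by
    obtain ⟨a, ha, h⟩ := hδ x hx
    obtain ⟨b, hb, h'⟩ := hγ (δ x) (by simpa using hx)
    refine ⟨a + b + b * a, add_mem (add_mem ha hb) (Ideal.mul_mem_left _ _ ha), ?_⟩
    rw [AlgEquiv.mul_apply, h', h]
    push_cast
    ring
  inv_mem' {γ} hγ x hx := by
    obtain ⟨a, ha, h⟩ := hγ (γ⁻¹ x) (by simpa using hx)
    obtain ⟨u, hu⟩ := (Ideal.mem_jacobson_bot.mp ha) 1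
    refine ⟨-a * (u⁻¹ : (IntBar F)ˣ), Ideal.mul_mem_right _ _ (neg_mem ha), ?_⟩
    have hu' : (1 + (a : AlgebraicClosure F)) * ((u⁻¹ : (IntBar F)ˣ) : IntBar F) = 1 := by
      have := congrArg (fun z : IntBar F => (z : AlgebraicClosure F)) u.mul_inv
      rw [hu] at this
      simpa [add_comm] using this
    have hx' : x = (1 + (a : AlgebraicClosure F)) * γ⁻¹ x := by
      rw [← h, ← AlgEquiv.mul_apply, mul_inv_cancel, AlgEquiv.one_apply]
    generalize hy : γ⁻¹ x = y at hx' ⊢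
    subst hx'
    push_cast
    linear_combination (a * y) * hu'

instance : (wildInertia F).Normal where
  conj_mem i hi γ x hx := by
    obtain ⟨a, ha, h⟩ := hi (γ⁻¹ x) (by simpa using hx)
    refine ⟨γ • a, smul_mem_maxBar γ ha, ?_⟩
    rw [AlgEquiv.mul_apply, AlgEquiv.mul_apply, h, map_mul, map_add, map_one,
      ← AlgEquiv.mul_apply, mul_inv_cancel, AlgEquiv.one_apply]
    rfl

/-- The choice of a lift `σ` of the arithmetic Frobenius and of a topological generator `τ` of the
tame inertia group `I_F / P_F ⊆ Γ_F / P_F`. -/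
structure TameChoice where
  σ : AbsGal F
  frob : ∀ x : IntBar F, σ • x - x ^ resCard F ∈ maxBar F
  τ : AbsGal F ⧸ wildInertia F
  gen : (Subgroup.zpowers τ).topologicalClosure =
    (inertia F).map (QuotientGroup.mk' (wildInertia F))

variable {F} (c : TameChoice F)

namespace TameChoice

/-- The discretized group `Γ_{F,ι}`: the preimage in `Γ_F` of the subgroup of `Γ_F / P_F`
generated by `σ` and `τ`, that is, the pullback of `Γ_F` along the injection
`ι : ⟨σ, τ ∣ σ τ σ⁻¹ = τ ^ q⟩ ↪ Γ_F / P_F`. -/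
def disc : Subgroup (AbsGal F) :=
  (Subgroup.closure {QuotientGroup.mk' (wildInertia F) c.σ, c.τ}).comap
    (QuotientGroup.mk' (wildInertia F))

theorem wildInertia_le_inertia : wildInertia F ≤ inertia F := by
  intro γ hγ x
  by_cases hx : x = 0
  · simp [hx]
  obtain ⟨a, ha, h⟩ := hγ x (by simpa using hx)
  have : γ • x - x = a * x := by
    apply Subtype.ext
    have h2 : ((γ • x : IntBar F) : AlgebraicClosure F) = (1 + a) * x := h
    push_cast
    rw [h2]
    ring
  rw [this]
  exact Ideal.mul_mem_right _ _ ha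

theorem σ_mem : c.σ ∈ c.disc :=
  Subgroup.subset_closure (Set.mem_insert _ _)

theorem τ_mem : c.τ ∈ (inertia F).map (QuotientGroup.mk' (wildInertia F)) := by
  rw [← c.gen]
  exact Subgroup.le_topologicalClosure _ (Subgroup.mem_zpowers _)

theorem exists_deg (γ : c.disc) : ∃ n : ℤ, (γ : AbsGal F) * c.σ ^ (-n) ∈ inertia F := by
  let π := QuotientGroup.mk' (inertia F)
  have key : c.disc ≤ (Subgroup.zpowers (π c.σ)).comap π := by
    have hle : wildInertia F ≤ π.ker := by
      rw [QuotientGroup.ker_mk']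
      exact wildInertia_le_inertia
    let π' : AbsGal F ⧸ wildInertia F →* AbsGal F ⧸ inertia F :=
      QuotientGroup.lift _ π hle
    have h1 : Subgroup.closure {QuotientGroup.mk' (wildInertia F) c.σ, c.τ} ≤
        (Subgroup.zpowers (π c.σ)).comap π' := by
      rw [Subgroup.closure_le]
      rintro x (rfl | rfl)
      · exact Subgroup.mem_zpowers _
      · obtain ⟨i, hi, hi'⟩ := c.τ_mem
        have : π' c.τ = 1 := by
          rw [← hi']
          exact (QuotientGroup.eq_one_iff i).mpr hi
        change π' c.τ ∈ Subgroup.zpowers (π c.σ)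
        rw [this]
        exact one_mem _
    intro γ hγ
    exact h1 hγ
  obtain ⟨n, hn⟩ := key γ.2
  refine ⟨n, (QuotientGroup.eq_one_iff (N := inertia F) _).mp ?_⟩
  change π (γ * c.σ ^ (-n)) = 1
  rw [map_mul, map_zpow, ← hn]
  simp

theorem frob_pow (n : ℕ) (x : IntBar F) :
    c.σ ^ n • x - x ^ (resCard F ^ n) ∈ maxBar F := by
  induction n with
  | zero => simp
  | succ n ih =>
    have h1 := smul_mem_maxBar c.σ ih
    have h2 := c.frob (x ^ (resCard F ^ n))
    have := add_mem h1 h2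
    rw [pow_succ' c.σ, mul_smul, pow_succ (resCard F), pow_mul]
    convert this using 1
    rw [smul_sub]
    ring

theorem one_lt_resCard : 1 < resCard F := Finite.one_lt_card

theorem infinite_quotient (M : Ideal (IntBar F)) [M.IsMaximal] : Infinite (IntBar F ⧸ M) := by
  let _ := Ideal.Quotient.field M
  have : IsAlgClosed (IntBar F ⧸ M) := by
    refine IsAlgClosed.of_exists_root _ fun f hf hirr => ?_
    obtain ⟨g, hg, hdeg, hmon⟩ := Polynomial.lifts_and_natDegree_eq_and_monic
      (f := Ideal.Quotient.mk M) (p := f)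
      ((Polynomial.mem_lifts _).mpr (Polynomial.map_surjective _ Ideal.Quotient.mk_surjective f)) hf
    have hd : (g.map (algebraMap (IntBar F) (AlgebraicClosure F))).degree ≠ 0 := by
      rw [hmon.degree_map]
      intro h0
      have h1 := Polynomial.natDegree_eq_of_degree_eq_some h0
      rw [hdeg] at h1
      exact hirr.natDegree_pos.ne' h1
    obtain ⟨z, hz⟩ := IsAlgClosed.exists_root _ hd
    have hzS : IsIntegral (IntBar F) z :=
      ⟨g, hmon, by rwa [Polynomial.IsRoot.def, Polynomial.eval_map] at hz⟩
    have hzO : IsIntegral 𝒪[F] z := isIntegral_trans z hzS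
    refine ⟨Ideal.Quotient.mk M ⟨z, hzO⟩, ?_⟩
    rw [← hg, Polynomial.eval_map, Polynomial.eval₂_hom]
    have : g.eval (⟨z, hzO⟩ : IntBar F) = 0 := by
      apply Subtype.ext
      rw [Polynomial.IsRoot.def, Polynomial.eval_map] at hz
      have h2 := Polynomial.eval₂_hom (p := g) (algebraMap (IntBar F) (AlgebraicClosure F))
        (⟨z, hzO⟩ : IntBar F)
      exact h2.symm.trans hz
    rw [this, map_zero]
  exact IsAlgClosed.instInfinite

theorem deg_unique {n : ℤ} (h : c.σ ^ n ∈ inertia F) : n = 0 := by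
  wlog hn : 0 ≤ n generalizing n
  · have := this (n := -n) (by rw [zpow_neg]; exact inv_mem h) (by omega)
    omega
  by_contra hne
  obtain ⟨m, rfl⟩ := Int.eq_ofNat_of_zero_le hn
  have hm : m ≠ 0 := by rintro rfl; simp at hne
  rw [zpow_natCast] at h
  obtain ⟨M, hM⟩ := Ideal.exists_maximal (IntBar F)
  have hle : maxBar F ≤ M := sInf_le ⟨bot_le, hM⟩
  let _ := Ideal.Quotient.field M
  have := infinite_quotient M
  have hN : 1 < resCard F ^ m := Nat.one_lt_pow hm one_lt_resCard
  have hroot : ∀ y : IntBar F ⧸ M, y ^ (resCard F ^ m) - y = 0 := by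
    intro y
    obtain ⟨x, rfl⟩ := Ideal.Quotient.mk_surjective y
    have h1 : c.σ ^ m • x - x - (c.σ ^ m • x - x ^ resCard F ^ m) ∈ maxBar F :=
      sub_mem (h x) (c.frob_pow m x)
    have h2 : x ^ (resCard F ^ m) - x ∈ M := by
      refine hle ?_
      convert h1 using 1
      ring
    rw [← map_pow, ← map_sub]
    exact Ideal.Quotient.eq_zero_iff_mem.mpr h2
  have hp : (Polynomial.X ^ (resCard F ^ m) - Polynomial.X : Polynomial (IntBar F ⧸ M)) = 0 :=
    Polynomial.eq_zero_of_infinite_isRoot _ (by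
      have : {x | (Polynomial.X ^ (resCard F ^ m) - Polynomial.X :
        Polynomial (IntBar F ⧸ M)).IsRoot x} = Set.univ := by
        ext y
        simpa using hroot y
      rw [this]
      exact Set.infinite_univ)
  exact FiniteField.X_pow_card_sub_X_ne_zero _ hN hp

/-- The degree `Γ_{F,ι} → ℤ`: an element has degree `n` if it acts on the residue field of `F̄` as
the `n`-th power of the arithmetic Frobenius. -/
def deg (γ : c.disc) : ℤ := (c.exists_deg γ).choose

theorem deg_spec (γ : c.disc) : (γ : AbsGal F) * c.σ ^ (-c.deg γ) ∈ inertia F :=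
  (c.exists_deg γ).choose_spec

theorem deg_eq {γ : c.disc} {n : ℤ} (h : (γ : AbsGal F) * c.σ ^ (-n) ∈ inertia F) :
    c.deg γ = n := by
  have h1 := mul_mem (inv_mem (c.deg_spec γ)) h
  have h2 : c.σ ^ (c.deg γ - n) ∈ inertia F := by
    convert h1 using 1
    rw [mul_inv_rev, mul_assoc, inv_mul_cancel_left, ← zpow_neg, neg_neg, ← zpow_add,
      sub_eq_add_neg]
  have := c.deg_unique h2
  omega

theorem deg_one : c.deg 1 = 0 := c.deg_eq (by simp)

theorem deg_mul (γ δ : c.disc) : c.deg (γ * δ) = c.deg γ + c.deg δ := by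
  apply c.deg_eq
  have h1 := mul_mem (c.deg_spec γ)
    ((inferInstance : (inertia F).Normal).conj_mem _ (c.deg_spec δ) (c.σ ^ c.deg γ))
  convert h1 using 1
  simp only [Subgroup.coe_mul, neg_add, zpow_add, zpow_neg]
  group

theorem deg_σ : c.deg ⟨c.σ, c.σ_mem⟩ = 1 := c.deg_eq (by simp)

theorem deg_inertia {γ : c.disc} (h : (γ : AbsGal F) ∈ inertia F) : c.deg γ = 0 :=
  c.deg_eq (by simpa using h)

variable (Ft : IntermediateField F (AlgebraicClosure F)) [FiniteDimensional F Ft] [IsGalois F Ft]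

/-- The restriction `Γ_F → Gal(F̃/F)`. -/
def restr : AbsGal F →* (Ft ≃ₐ[F] Ft) := AlgEquiv.restrictNormalHom Ft

/-- The character `χ : Γ_{F,ι} → 𝔾ₘ(A) × Gal(F̃/F)`, sending an element `γ` of degree `n` to
`(q ^ (-n), γ|F̃)`. -/
def chi (A : Type*) [CommRing A] [Algebra (BaseRing F) A] : c.disc →* Aˣ × (Ft ≃ₐ[F] Ft) where
  toFun γ := (Units.map (algebraMap (BaseRing F) A) (qUnit F) ^ (-c.deg γ), restr Ft γ)
  map_one' := by simp [deg_one]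
  map_mul' γ δ := by
    rw [deg_mul, neg_add, zpow_add]
    simp

end TameChoice
end Galois

section Parameters

variable {F : Type w} [Field F] [ValuativeRel F] [TopologicalSpace F]
  [IsNonarchimedeanLocalField F]
  (Ft : IntermediateField F (AlgebraicClosure F)) [FiniteDimensional F Ft] [IsGalois F Ft]

/-- An affine group scheme `Ĝ` over `ℤ[1/p]` (a representable group functor) with an action of
`𝔾ₘ × Gal(F̃/F)` by group automorphisms. For the dual group of a reductive group over `F` that
splits over `F̃`, with the Galois action by pinned automorphisms and `𝔾ₘ` acting through the
cocharacter `ρ_ad` of the adjoint group, the semidirect product is the C-group. -/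
structure CGroupDatum where
  grp : CommAlgCat.{u} (BaseRing F) ⥤ GrpCat.{u}
  affine : (grp ⋙ forget GrpCat).IsCorepresentable
  act : ∀ A : CommAlgCat.{u} (BaseRing F), Aˣ × (Ft ≃ₐ[F] Ft) →* MulAut (grp.obj A)
  natural : ∀ {A B : CommAlgCat.{u} (BaseRing F)} (f : A ⟶ B) (t : Aˣ × (Ft ≃ₐ[F] Ft))
    (g : grp.obj A), grp.map f (act A t g) =
      act B (Units.map f.hom.toRingHom t.1, t.2) (grp.map f g)

namespace CGroupDatum

variable {Ft} (D : CGroupDatum.{u} Ft)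

theorem isSheaf : (grpPsh D.grp).IsSheaf :=
  haveI := D.affine
  isSheaf_of_isCorepresentable D.grp

/-- The points `Ĝ(A) ⋊ (𝔾ₘ(A) × Gal(F̃/F))` of the C-group whose component in the constant group
`Gal(F̃/F)` is constant on `Spec A`. All points that occur below lie over such constant elements. -/
abbrev CG (A : CommAlgCat.{u} (BaseRing F)) : Type _ :=
  SemidirectProduct (D.grp.obj A) (Aˣ × (Ft ≃ₐ[F] Ft)) (D.act A)

/-- Functoriality of `𝔾ₘ(A) × Gal(F̃/F)`. -/
def torMap {A B : CommAlgCat.{u} (BaseRing F)} (f : A ⟶ B) :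
    Aˣ × (Ft ≃ₐ[F] Ft) →* Bˣ × (Ft ≃ₐ[F] Ft) :=
  (Units.map f.hom.toRingHom.toMonoidHom).prodMap (MonoidHom.id _)

/-- Functoriality of the points of the C-group. -/
def cgMap {A B : CommAlgCat.{u} (BaseRing F)} (f : A ⟶ B) : D.CG A →* D.CG B :=
  SemidirectProduct.map (D.grp.map f).hom (torMap f) fun t => by
    ext g
    exact D.natural f t g

theorem cgMap_id {A : CommAlgCat.{u} (BaseRing F)} (x : D.CG A) : D.cgMap (𝟙 A) x = x := by
  ext <;> simp [cgMap, torMap]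

theorem cgMap_comp {A B C : CommAlgCat.{u} (BaseRing F)} (f : A ⟶ B) (g : B ⟶ C) (x : D.CG A) :
    D.cgMap (f ≫ g) x = D.cgMap g (D.cgMap f x) := by
  ext <;> simp [cgMap, torMap]

theorem cgMap_inl {A B : CommAlgCat.{u} (BaseRing F)} (f : A ⟶ B) (g : D.grp.obj A) :
    D.cgMap f (SemidirectProduct.inl g) = SemidirectProduct.inl (D.grp.map f g) := by
  ext <;> simp [cgMap]

/-- The subgroup `Ĝ^I(A)` of points fixed by inertia. -/
def invSubgroup (A : CommAlgCat.{u} (BaseRing F)) : Subgroup (D.grp.obj A) where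
  carrier := {g | ∀ i ∈ inertia F, D.act A (1, TameChoice.restr Ft i) g = g}
  one_mem' i _ := map_one _
  mul_mem' ha hb i hi := by rw [map_mul, ha i hi, hb i hi]
  inv_mem' ha i hi := by rw [map_inv, ha i hi]

theorem map_mem_invSubgroup {A B : CommAlgCat.{u} (BaseRing F)} (f : A ⟶ B) {g : D.grp.obj A}
    (hg : g ∈ D.invSubgroup A) : D.grp.map f g ∈ D.invSubgroup B := by
  intro i hi
  have h := D.natural f (1, TameChoice.restr Ft i) g
  rw [hg i hi] at h
  simpa using h.symm

/-- The group scheme `Ĝ^I` of inertia invariants. -/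
def inv : CommAlgCat.{u} (BaseRing F) ⥤ GrpCat.{u} where
  obj A := GrpCat.of (D.invSubgroup A)
  map {A B} f := GrpCat.ofHom
    { toFun := fun g => ⟨D.grp.map f g.1, D.map_mem_invSubgroup f g.2⟩
      map_one' := Subtype.ext (map_one _)
      map_mul' := fun _ _ => Subtype.ext (map_mul _ _ _) }
  map_id A := by
    ext g
    simp
  map_comp f g := by
    ext x
    simp

/-- The inclusion `Ĝ^I ⟶ Ĝ`. -/
def incl : D.inv ⟶ D.grp where
  app A := GrpCat.ofHom (D.invSubgroup A).subtype
  naturality _ _ _ := rfl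

theorem act_mem_invSubgroup {A : CommAlgCat.{u} (BaseRing F)} (t : Aˣ) (γ : AbsGal F)
    {g : D.grp.obj A} (hg : g ∈ D.invSubgroup A) :
    D.act A (t, TameChoice.restr Ft γ) g ∈ D.invSubgroup A := by
  intro i hi
  have h1 := hg _ ((inferInstance : (inertia F).Normal).conj_mem i hi γ⁻¹)
  rw [← MulAut.mul_apply, ← map_mul]
  conv_rhs => rw [← h1, ← MulAut.mul_apply, ← map_mul]
  congr 2
  simp [mul_assoc]

variable (c : TameChoice F)

/-- The element `(q⁻¹, σ)` of `𝔾ₘ(A) × Gal(F̃/F)`. -/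
def frobElt (A : CommAlgCat.{u} (BaseRing F)) : Aˣ × (Ft ≃ₐ[F] Ft) :=
  ((Units.map (algebraMap (BaseRing F) A) (qUnit F))⁻¹, TameChoice.restr Ft c.σ)

theorem map_qUnit {A B : CommAlgCat.{u} (BaseRing F)} (f : A ⟶ B) :
    Units.map f.hom.toRingHom.toMonoidHom (Units.map (algebraMap (BaseRing F) A) (qUnit F)) =
      Units.map (algebraMap (BaseRing F) B) (qUnit F) :=
  Units.ext (f.hom.commutes _)

theorem torMap_frobElt {A B : CommAlgCat.{u} (BaseRing F)} (f : A ⟶ B) :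
    torMap f (frobElt c A : Aˣ × (Ft ≃ₐ[F] Ft)) = frobElt c B := by
  refine Prod.ext ?_ rfl
  change Units.map f.hom.toRingHom.toMonoidHom (_)⁻¹ = _
  rw [map_inv, map_qUnit]
  rfl

theorem torMap_chi {A B : CommAlgCat.{u} (BaseRing F)} (f : A ⟶ B) (γ : c.disc) :
    torMap f (c.chi Ft A γ) = c.chi Ft B γ := by
  refine Prod.ext ?_ rfl
  change Units.map f.hom.toRingHom.toMonoidHom
    (Units.map (algebraMap (BaseRing F) A) (qUnit F) ^ (-c.deg γ)) = _
  rw [map_zpow, map_qUnit]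
  rfl

theorem chi_eq (A : CommAlgCat.{u} (BaseRing F)) (γ : c.disc) :
    ∃ i ∈ inertia F, c.chi Ft A γ = frobElt c A ^ c.deg γ * (1, TameChoice.restr Ft i) := by
  refine ⟨c.σ ^ (-c.deg γ) * γ, ?_, ?_⟩
  · have h := (inferInstance : (inertia F).Normal).conj_mem _ (c.deg_spec γ) (c.σ ^ (-c.deg γ))
    convert h using 1
    group
  · refine Prod.ext ?_ ?_
    · simp [frobElt, TameChoice.chi]
    · simp [frobElt, TameChoice.chi]

/-- The space `Ĝ^I q⁻¹σ ⊆ ᶜG` with the conjugation action of `Ĝ^I`. -/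
def sphSpace : GSpace.{u} D.inv where
  obj A := {x : D.CG A // x.left ∈ D.invSubgroup A ∧ x.right = frobElt c A}
  map f x := ⟨D.cgMap f x.1, D.map_mem_invSubgroup f x.2.1, by
    have h := congrArg (torMap f) x.2.2
    rw [torMap_frobElt] at h
    exact h⟩
  map_id x := Subtype.ext (D.cgMap_id _)
  map_comp f g x := Subtype.ext (D.cgMap_comp f g _)
  smul {A} h x := ⟨SemidirectProduct.inl h.1 * x.1 * (SemidirectProduct.inl h.1)⁻¹, by
    have h1 := D.act_mem_invSubgroup (Units.map (algebraMap (BaseRing F) A) (qUnit F))⁻¹ c.σ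
      (inv_mem h.2)
    have h2 := mul_mem (mul_mem h.2 x.2.1) h1
    have h3 : D.act A x.1.right h.1⁻¹ = D.act A (frobElt c A) h.1⁻¹ := by rw [x.2.2]
    simp only [← map_inv, SemidirectProduct.mul_left, SemidirectProduct.left_inl,
      SemidirectProduct.mul_right, SemidirectProduct.right_inl, map_one, MulAut.one_apply, one_mul,
      h3]
    exact h2, by simp [x.2.2]⟩
  one_smul x := Subtype.ext (by
    change SemidirectProduct.inl 1 * x.1 * (SemidirectProduct.inl 1)⁻¹ = x.1
    simp)
  mul_smul g h x := Subtype.ext (by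
    change SemidirectProduct.inl (g.1 * h.1) * x.1 * (SemidirectProduct.inl (g.1 * h.1))⁻¹ =
      SemidirectProduct.inl g.1 * (SemidirectProduct.inl h.1 * x.1 *
        (SemidirectProduct.inl h.1)⁻¹) * (SemidirectProduct.inl g.1)⁻¹
    simp [mul_assoc])
  map_smul f g x := Subtype.ext (by
    change D.cgMap f (SemidirectProduct.inl g.1 * x.1 * (SemidirectProduct.inl g.1)⁻¹) =
      SemidirectProduct.inl (D.grp.map f g.1) * D.cgMap f x.1 *
        (SemidirectProduct.inl (D.grp.map f g.1))⁻¹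
    simp only [map_mul, map_inv, cgMap_inl])

/-- The space `Loc^□` of framed Langlands parameters: homomorphisms `ρ : Γ_{F,ι} ⟶ ᶜG(A)` with
`d ∘ ρ = χ` that are trivial on an open subgroup of the wild inertia group; `Ĝ` acts by
conjugation. This is the filtered union, over the finite extensions `L` of the maximal tame
extension, of the schemes of parameters that factor through the quotient by `Gal(F̄/L)`. -/
def locSpace : GSpace.{u} D.grp where
  obj A := {ρ : c.disc →* D.CG A // (∀ γ, (ρ γ).right = c.chi Ft A γ) ∧
    ∃ E : IntermediateField F (AlgebraicClosure F), FiniteDimensional F E ∧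
      ∀ γ : c.disc, (γ : AbsGal F) ∈ wildInertia F → (γ : AbsGal F) ∈ E.fixingSubgroup → ρ γ = 1}
  map f ρ := ⟨(D.cgMap f).comp ρ.1, fun γ => by
    rw [← torMap_chi c f, ← ρ.2.1]; rfl, by
      obtain ⟨E, hE, h⟩ := ρ.2.2
      exact ⟨E, hE, fun γ h1 h2 => by simp [h γ h1 h2]⟩⟩
  map_id ρ := Subtype.ext (by ext1 γ; exact D.cgMap_id _)
  map_comp f g ρ := Subtype.ext (by ext1 γ; exact D.cgMap_comp f g _)
  smul g ρ := ⟨(MulAut.conj (SemidirectProduct.inl g)).toMonoidHom.comp ρ.1,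
    fun γ => by simp [ρ.2.1], by
      obtain ⟨E, hE, h⟩ := ρ.2.2
      exact ⟨E, hE, fun γ h1 h2 => by simp [h γ h1 h2]⟩⟩
  one_smul ρ := Subtype.ext (by ext1 γ; simp)
  mul_smul g h ρ := Subtype.ext (by ext1 γ; simp [mul_assoc])
  map_smul f g ρ := Subtype.ext (by
    ext1 γ
    simp [cgMap_inl])

theorem locSpace_isSheaf : (D.locSpace c).toPsh.IsSheaf := by
  intro A B f hf ρ hρ
  have hinj : ∀ {g h : D.grp.obj A}, D.grp.map f g = D.grp.map f h → g = h := by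
    intro g h e
    exact (D.isSheaf f hf (D.grp.map f h) (fun u v huv => by
      change D.grp.map u (D.grp.map f h) = D.grp.map v (D.grp.map f h)
      rw [← ConcreteCategory.comp_apply, ← ConcreteCategory.comp_apply, ← Functor.map_comp,
        ← Functor.map_comp, huv])).unique e rfl
  have hex : ∀ γ, ∃ g : D.grp.obj A, D.grp.map f g = (ρ.1 γ).left := fun γ =>
    (D.isSheaf f hf (ρ.1 γ).left fun u v huv =>
      congrArg (fun t : (D.locSpace c).obj _ => (t.1 γ).left) (hρ u v huv)).exists
  choose g hg using hex
  have hval : ∀ γ, D.cgMap f ⟨g γ, c.chi Ft A γ⟩ = ρ.1 γ := by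
    intro γ
    refine SemidirectProduct.ext (hg γ) ?_
    rw [ρ.2.1 γ]
    exact torMap_chi c f γ
  have hcg : ∀ {x y : D.CG A}, x.right = y.right → D.cgMap f x = D.cgMap f y → x = y := by
    intro x y h1 h2
    exact SemidirectProduct.ext (hinj (congrArg SemidirectProduct.left h2)) h1
  refine ⟨⟨{ toFun := fun γ => ⟨g γ, c.chi Ft A γ⟩, map_one' := ?_, map_mul' := ?_ },
    fun γ => rfl, ?_⟩, ?_, ?_⟩
  · apply hcg
    · simp
    · rw [hval, map_one, map_one]
  · intro γ δ
    apply hcg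
    · simp
    · rw [hval, map_mul, map_mul, hval, hval]
  · obtain ⟨E, hE, h⟩ := ρ.2.2
    refine ⟨E, hE, fun γ h1 h2 => ?_⟩
    have h3 := h γ h1 h2
    apply hcg
    · have h4 := ρ.2.1 γ
      rw [h3] at h4
      refine Prod.ext ?_ (congrArg Prod.snd h4).symm
      change Units.map (algebraMap (BaseRing F) A : BaseRing F →* A) (qUnit F) ^ (-c.deg γ) = 1
      rw [c.deg_inertia (TameChoice.wildInertia_le_inertia h1), neg_zero, zpow_zero]
    · exact (hval γ).trans (h3.trans (map_one _).symm)
  · refine Subtype.ext ?_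
    ext1 γ
    exact hval γ
  · intro ρ' h
    refine Subtype.ext ?_
    ext1 γ
    apply hcg
    · exact ρ'.2.1 γ
    · have h1 := congrArg (fun t : (D.locSpace c).obj _ => t.1 γ) h
      exact h1.trans (hval γ).symm

theorem act_mem_invSubgroup' {A : CommAlgCat.{u} (BaseRing F)} (t : Aˣ × (Ft ≃ₐ[F] Ft))
    {g : D.grp.obj A} (hg : g ∈ D.invSubgroup A) : D.act A t g ∈ D.invSubgroup A := by
  obtain ⟨t, δ⟩ := t
  obtain ⟨γ, rfl⟩ : ∃ γ, TameChoice.restr Ft γ = δ :=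
    AlgEquiv.restrictNormalHom_surjective (AlgebraicClosure F) δ
  exact D.act_mem_invSubgroup t γ hg

/-- The subgroup of the points of the C-group whose component in `Ĝ` is fixed by inertia. -/
def cgInv (A : CommAlgCat.{u} (BaseRing F)) : Subgroup (D.CG A) where
  carrier := {y | y.left ∈ D.invSubgroup A}
  one_mem' := one_mem (D.invSubgroup A)
  mul_mem' hx hy := mul_mem (S := Subgroup (D.grp.obj A)) hx (D.act_mem_invSubgroup' _ hy)
  inv_mem' {x} hx := D.act_mem_invSubgroup' x.right⁻¹ (inv_mem hx)

theorem zpow_left_mem {A : CommAlgCat.{u} (BaseRing F)} (x : (D.sphSpace c).obj A) (n : ℤ) :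
    (x.1 ^ n).left ∈ D.invSubgroup A :=
  have h : x.1 ∈ D.cgInv A := x.2.1
  have h2 : x.1 ^ n ∈ D.cgInv A := zpow_mem h n
  h2

theorem zpow_right {A : CommAlgCat.{u} (BaseRing F)} (x : (D.sphSpace c).obj A) (n : ℤ) :
    (x.1 ^ n).right = frobElt c A ^ n :=
  (map_zpow (SemidirectProduct.rightHom (φ := D.act A)) x.1 n).trans
    (congrArg (fun t => t ^ n) x.2.2)

/-- On `Ĝ^I`, the element `χ(γ)` acts as the power of `(q⁻¹, σ)` given by the degree of `γ`. -/
theorem act_chi {A : CommAlgCat.{u} (BaseRing F)} (γ : c.disc) {g : D.grp.obj A}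
    (hg : g ∈ D.invSubgroup A) :
    D.act A (c.chi Ft A γ) g = D.act A (frobElt c A ^ c.deg γ) g := by
  obtain ⟨i, hi, h⟩ := chi_eq (Ft := Ft) c A γ
  rw [h, map_mul, MulAut.mul_apply, hg i hi]

/-- The parameter attached to a point `x = g q⁻¹σ` of `Ĝ^I q⁻¹σ`: it is trivial on inertia and
sends `σ` to `x`. -/
def sphParam {A : CommAlgCat.{u} (BaseRing F)} (x : (D.sphSpace c).obj A) : c.disc →* D.CG A where
  toFun γ := ⟨(x.1 ^ c.deg γ).left, c.chi Ft A γ⟩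
  map_one' := by
    rw [c.deg_one]
    ext <;> simp
  map_mul' γ δ := by
    refine SemidirectProduct.ext ?_ (map_mul _ _ _)
    simp only [SemidirectProduct.mul_left]
    rw [c.deg_mul, zpow_add, SemidirectProduct.mul_left, D.zpow_right,
      D.act_chi c γ (D.zpow_left_mem c x _)]

theorem sphParam_inertia {A : CommAlgCat.{u} (BaseRing F)} (x : (D.sphSpace c).obj A) (γ : c.disc)
    (h : (γ : AbsGal F) ∈ inertia F) :
    D.sphParam c x γ = SemidirectProduct.inr (1, TameChoice.restr Ft γ) := by
  have h0 := c.deg_inertia h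
  refine SemidirectProduct.ext ?_ ?_
  · change (x.1 ^ c.deg γ).left = 1
    rw [h0]
    simp
  · simp [sphParam, TameChoice.chi, h0]

theorem sphParam_σ {A : CommAlgCat.{u} (BaseRing F)} (x : (D.sphSpace c).obj A) :
    D.sphParam c x ⟨c.σ, c.σ_mem⟩ = x.1 := by
  refine SemidirectProduct.ext ?_ ?_
  · change (x.1 ^ c.deg _).left = _
    rw [c.deg_σ, zpow_one]
  · rw [x.2.2]
    simp [sphParam, TameChoice.chi, c.deg_σ, frobElt]

/-- The map `Ĝ^I q⁻¹σ ⟶ Loc^□`. -/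
def sphToLoc : GSpace.MapAlong D.incl (D.sphSpace c) (D.locSpace c) where
  app x := ⟨D.sphParam c x, fun γ => rfl, Ft, inferInstance, fun γ h1 h2 => by
    rw [D.sphParam_inertia c x γ (TameChoice.wildInertia_le_inertia h1)]
    have h3 : TameChoice.restr Ft (γ : AbsGal F) = 1 := by
      have := IntermediateField.restrictNormalHom_ker Ft
      rw [← this] at h2
      exact h2
    rw [h3]
    exact map_one _⟩
  natural {A B} f x := Subtype.ext (by
    ext1 γ
    refine SemidirectProduct.ext ?_ (torMap_chi c f γ).symm
    change ((D.cgMap f x.1) ^ c.deg γ).left = (D.cgMap f ⟨(x.1 ^ c.deg γ).left, _⟩).left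
    rw [← map_zpow]
    rfl)
  equivariant {A} h x := Subtype.ext (by
    ext1 γ
    have hh : (SemidirectProduct.inl h.1 * x.1 * (SemidirectProduct.inl h.1)⁻¹) ^ c.deg γ =
        SemidirectProduct.inl h.1 * x.1 ^ c.deg γ * (SemidirectProduct.inl h.1)⁻¹ :=
      conj_zpow
    refine SemidirectProduct.ext ?_ ?_
    · change ((SemidirectProduct.inl h.1 * x.1 * (SemidirectProduct.inl h.1)⁻¹) ^ c.deg γ).left =
        (SemidirectProduct.inl h.1 * (⟨(x.1 ^ c.deg γ).left, c.chi Ft A γ⟩ : D.CG A) *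
          (SemidirectProduct.inl h.1)⁻¹).left
      rw [hh]
      have h1 := D.zpow_right c x (c.deg γ)
      have h2 := D.act_chi c γ (inv_mem h.2)
      simp only [← map_inv, SemidirectProduct.mul_left, SemidirectProduct.left_inl,
        SemidirectProduct.mul_right, SemidirectProduct.right_inl, map_one, MulAut.one_apply,
        one_mul, h1]
      rw [h2]
    · change c.chi Ft A γ = (SemidirectProduct.inl h.1 *
        (⟨(x.1 ^ c.deg γ).left, c.chi Ft A γ⟩ : D.CG A) * (SemidirectProduct.inl h.1)⁻¹).right
      simp)

/-- The stack `Loc = Loc^□ / Ĝ` of Langlands parameters. -/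
abbrev Loc : Type _ := QuotStack (D.locSpace c)

/-- The stack `Loc^sph = Ĝ^I q⁻¹σ / Ĝ^I` of spherical Langlands parameters. -/
abbrev LocSph : Type _ := QuotStack (D.sphSpace c)

/-- The morphism of stacks `Φ : Loc^sph ⟶ Loc`. -/
def Φ : D.LocSph c ⥤ D.Loc c :=
  QuotStack.mapAlong D.incl D.isSheaf (D.sphToLoc c) (D.locSpace_isSheaf c)

/-- Restriction of modules along `Φ : Loc^sph ⟶ Loc`. -/
def pullbackΦ : QuotStack.Mod (D.locSpace c) ⥤ QuotStack.Mod (D.sphSpace c) :=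
  QuotStack.pullbackAlong D.incl D.isSheaf (D.sphToLoc c) (D.locSpace_isSheaf c)

/-- The functor sending a representation `V` of `Ĝ` to the vector bundle on `Loc^sph` defined by
the restriction of `V` to `Ĝ^I`. -/
def sphBundle : FinRep D.grp ⥤ QuotStack.Mod (D.sphSpace c) :=
  FinRep.res D.incl ⋙ FinRep.tilde (D.sphSpace c)

/-- The functor sending a representation `V` of `Ĝ` to the restriction along `Φ : Loc^sph ⟶ Loc` of
the vector bundle `Ṽ` on `Loc`. -/
def locBundle : FinRep D.grp ⥤ QuotStack.Mod (D.sphSpace c) :=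
  FinRep.tilde (D.locSpace c) ⋙ D.pullbackΦ c

/-- An isomorphism is canonical if, at every object `(P, φ)` of `Loc^sph`, it sends a section
`[p, s(p)]` of `P ×^{Ĝ^I} V` to the section `[[p, 1], s(p)]` of `(P ×^{Ĝ^I} Ĝ) ×^Ĝ V`. -/
def IsCanonical (θ : D.sphBundle c ≅ D.locBundle c) : Prop :=
  ∀ (V : FinRep D.grp) (x : D.LocSph c)
    (s : ((FinRep.res D.incl).obj V).Sections x.torsor)
    {B : CommAlgCat.{u} (BaseRing F)} {b : x.ring ⟶ B} (p : x.torsor.pt b),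
    FinRep.Sections.val (V := V) (P := x.torsor.induce D.incl D.isSheaf)
      ((θ.hom.app V).app (Opposite.op x) s) (x.torsor.toInduce D.incl D.isSheaf p) = s.val p

end CGroupDatum

end Parameters
end LanglandsParameters
end

/-!
Sending `p` to `[p, 1]` gives a map `P ⟶ P ×^H G` that is equivariant along `i : H ⟶ G`, so that
sections of `(P ×^H G) ×^G V` restrict to sections of `P ×^H V`. The restriction map is injective,
because every point of `P ×^H G` is locally of the form `[p, 1] g`, and it is surjective, because
an equivariant map `P ⟶ V` extends uniquely along `P ⟶ P ×^H G`. Its inverse is the canonical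
isomorphism, and it is determined by the values of sections at the points `[p, 1]`.

That the sections of `P ×^G V` form a vector bundle is faithfully flat descent. If `A ⟶ B` is a
covering and `p` is a point of `P` over `B`, evaluation at `p` identifies the sections over `A` with
the elements of `B ⊗ V` that are fixed by the descent datum on `B ⊗_A B ⊗ V` given by the element
`g` of `G(B ⊗_A B)` that relates the two pullbacks of `p`. The Amitsur complex of `B ⊗ V` twisted
by `g` becomes split exact after base change to `B`, so `B ⊗ V` is the base change of the sections.
Finiteness, projectivity and compatibility with base change then descend from `B ⊗ V`.
-/

noncomputable section

namespace LanglandsParameters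

section FaithfullyFlatDescent

variable {R S : Type*} [CommRing R] [CommRing S] [Algebra R S]

theorem finitePresentation_of_faithfullyFlat [Module.FaithfullyFlat R S] {M : Type*}
    [AddCommGroup M] [Module R M] [Module.FinitePresentation S (S ⊗[R] M)] :
    Module.FinitePresentation R M := by
  have : Module.Finite R M := .of_finite_tensorProduct_of_faithfullyFlat S
  obtain ⟨n, π, hπ⟩ := Module.Finite.exists_fin' R M
  have : Module.Finite S (AlgebraTensorModule.lTensor S S π).ker :=
    Module.Finite.iff_fg.mpr
      (Module.FinitePresentation.fg_ker _ (LinearMap.lTensor_surjective S hπ))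
  have : Module.Finite S (S ⊗[R] π.ker) := .equiv (LinearMap.tensorKerEquiv S S π).symm
  have : Module.Finite R π.ker := .of_finite_tensorProduct_of_faithfullyFlat S
  exact Module.finitePresentation_of_surjective π hπ (Module.Finite.iff_fg.mp this)

theorem finite_projective_of_isBaseChange [Module.FaithfullyFlat R S] {M N : Type*}
    [AddCommGroup M] [Module R M] [AddCommGroup N] [Module R N] [Module S N] [IsScalarTower R S N]
    [Module.Finite S N] [Module.Projective S N] {f : M →ₗ[R] N} (hf : IsBaseChange S f) :
    Module.Finite R M ∧ Module.Projective R M := by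
  have : Module.Finite S (S ⊗[R] M) := .equiv hf.equiv.symm
  have : Module.Projective S (S ⊗[R] M) := .of_equiv hf.equiv.symm
  have : Module.FinitePresentation S (S ⊗[R] M) := Module.finitePresentation_of_projective _ _
  have : Module.FinitePresentation R M := finitePresentation_of_faithfullyFlat (S := S)
  have : Module.Flat R M := (Module.Flat.iff_flat_tensorProduct R M S).mp inferInstance
  exact ⟨inferInstance, Module.Flat.projective_of_finitePresentation⟩

theorem bijective_of_isBaseChange_comp [Module.FaithfullyFlat R S] {M N K : Type*}
    [AddCommGroup M] [Module R M] [AddCommGroup N] [Module R N] [AddCommGroup K] [Module R K]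
    [Module S K] [IsScalarTower R S K] {f : M →ₗ[R] N} {g : N →ₗ[R] K} (hg : IsBaseChange S g)
    (hgf : IsBaseChange S (g ∘ₗ f)) : Function.Bijective f := by
  have hcomp : hg.equiv.toLinearMap ∘ₗ f.baseChange S = hgf.equiv.toLinearMap := by
    ext m
    simp [IsBaseChange.equiv_tmul]
  rw [← Module.FaithfullyFlat.lTensor_bijective_iff_bijective R S,
    ← Function.Bijective.of_comp_iff' hg.equiv.bijective]
  exact (congrArg (fun φ : S ⊗[R] M →ₗ[S] K => Function.Bijective φ) hcomp).mpr hgf.equiv.bijective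

theorem isBaseChange_of_comp_faithfullyFlat {T : Type*} [CommRing T] [Algebra R T] [Algebra S T]
    [IsScalarTower R S T] [Module.FaithfullyFlat S T] {M N K : Type*} [AddCommGroup M] [Module R M]
    [AddCommGroup N] [Module R N] [Module S N] [IsScalarTower R S N]
    [AddCommGroup K] [Module R K] [Module S K] [Module T K] [IsScalarTower R S K]
    [IsScalarTower R T K] [IsScalarTower S T K] {f : M →ₗ[R] N} {g : N →ₗ[S] K}
    (hg : IsBaseChange T g) (hgf : IsBaseChange T (g.restrictScalars R ∘ₗ f)) :
    IsBaseChange S f := by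
  let φ : S ⊗[R] M →ₗ[S] N := (TensorProduct.isBaseChange R M S).lift f
  have hφ : φ.restrictScalars R ∘ₗ TensorProduct.mk R S M 1 = f := IsBaseChange.lift_comp _ f
  have hgφ : IsBaseChange T (g ∘ₗ φ) := (TensorProduct.isBaseChange R M S).of_comp <| by
    rwa [← hφ] at hgf
  exact .of_equiv (.ofBijective φ (bijective_of_isBaseChange_comp hg hgφ))
    fun m => LinearMap.congr_fun hφ m

end FaithfullyFlatDescent

section AlgebraMaps

variable {k : Type} [CommRing k]

/-- The structure map of an `A`-algebra `B`, as a morphism of `k`-algebras. It lets one switch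
between morphisms of `k`-algebras and algebra instances. -/
def algHom (A B : CommAlgCat.{u} k) [Algebra A B] [IsScalarTower k A B] : A ⟶ B :=
  CommAlgCat.ofHom (IsScalarTower.toAlgHom k A B)

theorem exists_algHom_eq {A B : CommAlgCat.{u} k} (f : A ⟶ B) :
    ∃ (_ : Algebra A B) (_ : IsScalarTower k A B), algHom A B = f := by
  let _ := f.hom.toRingHom.toAlgebra
  exact ⟨_, .of_algebraMap_eq fun x => (f.hom.commutes x).symm, rfl⟩

variable (A B C : CommAlgCat.{u} k) [Algebra A B] [IsScalarTower k A B]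
  [Algebra A C] [IsScalarTower k A C]

/-- The tensor product of the `A`-algebras `B` and `C`, as a `k`-algebra. -/
abbrev tensorObj : CommAlgCat.{u} k := .of k (B ⊗[A] C)

/-- The map `b ↦ b ⊗ 1`. -/
def inl : B ⟶ tensorObj A B C := CommAlgCat.ofHom Algebra.TensorProduct.includeLeft

/-- The map `c ↦ 1 ⊗ c`. -/
def inr : C ⟶ tensorObj A B C :=
  CommAlgCat.ofHom (Algebra.TensorProduct.includeRight.restrictScalars k)

theorem algHom_comp_inl : algHom A B ≫ inl A B C = algHom A C ≫ inr A B C := by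
  ext a
  exact Algebra.TensorProduct.tmul_one_eq_one_tmul a

theorem algHom_comp_inr : algHom A C ≫ inr A B C = algHom A (tensorObj A B C) :=
  (algHom_comp_inl A B C).symm

variable {A B C}

theorem tensorObj_hom_ext {D : CommAlgCat.{u} k} {t t' : tensorObj A B C ⟶ D}
    (hl : inl A B C ≫ t = inl A B C ≫ t') (hr : inr A B C ≫ t = inr A B C ≫ t') : t = t' := by
  ext x
  refine RingHom.congr_fun (Algebra.TensorProduct.ringHom_ext (f := t.hom.toRingHom)
    (g := t'.hom.toRingHom) ?_ ?_) x
  · ext b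
    exact congr($(hl).hom b)
  · ext c
    exact congr($(hr).hom c)

theorem exists_tensorObj_desc {D : CommAlgCat.{u} k} (u : B ⟶ D) (v : C ⟶ D)
    (huv : algHom A B ≫ u = algHom A C ≫ v) :
    ∃ t : tensorObj A B C ⟶ D, inl A B C ≫ t = u ∧ inr A B C ≫ t = v := by
  obtain ⟨_, _, hD⟩ := exists_algHom_eq (algHom A B ≫ u)
  let u' : B →ₐ[A] D :=
    { u.hom.toRingHom with commutes' := fun a => congr($(hD.symm).hom a) }
  let v' : C →ₐ[A] D :=
    { v.hom.toRingHom with commutes' := fun a => congr($((hD.trans huv).symm).hom a) }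
  have commute (b : B) (c : C) : Commute (u' b) (v' c) := .all _ _
  refine ⟨CommAlgCat.ofHom ((Algebra.TensorProduct.lift u' v' commute).restrictScalars k), ?_, ?_⟩
  · ext b
    exact DFunLike.congr_fun (Algebra.TensorProduct.lift_comp_includeLeft u' v' commute) b
  · ext c
    exact DFunLike.congr_fun (Algebra.TensorProduct.lift_comp_includeRight u' v' commute) c

variable (A B)

theorem algHom_exact_inl_sub_inr [Module.FaithfullyFlat A B] :
    Function.Exact (algHom A B).hom.toLinearMap
      ((inl A B B).hom.toLinearMap - (inr A B B).hom.toLinearMap) := by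
  intro b
  have heff := Algebra.IsEffective.of_faithfullyFlat A B b
  rwa [Algebra.TensorProduct.includeLeftSubRight_apply] at heff

/-- The map `b ⊗ c ↦ b ⊗ (c ⊗ 1)`. -/
def insertRight : tensorObj A B B ⟶ tensorObj A B (tensorObj A B B) :=
  CommAlgCat.ofHom ((Algebra.TensorProduct.map (.id A B)
    (Algebra.TensorProduct.includeLeft : B →ₐ[A] B ⊗[A] B)).restrictScalars k)

/-- The map `b ⊗ c ↦ b ⊗ (1 ⊗ c)`. -/
def insertMiddle : tensorObj A B B ⟶ tensorObj A B (tensorObj A B B) :=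
  CommAlgCat.ofHom ((Algebra.TensorProduct.map (.id A B)
    (Algebra.TensorProduct.includeRight : B →ₐ[A] B ⊗[A] B)).restrictScalars k)

theorem inl_insertRight : inl A B B ≫ insertRight A B = inl A B (tensorObj A B B) := by
  ext b
  exact (Algebra.TensorProduct.map_tmul _ _ b 1).trans (by rw [map_one]; rfl)

theorem inr_insertRight : inr A B B ≫ insertRight A B = inl A B B ≫ inr A B (tensorObj A B B) := by
  ext b
  exact Algebra.TensorProduct.map_tmul _ _ 1 b

theorem inl_insertMiddle : inl A B B ≫ insertMiddle A B = inl A B (tensorObj A B B) := by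
  ext b
  exact (Algebra.TensorProduct.map_tmul _ _ b 1).trans (by rw [map_one]; rfl)

theorem inr_insertMiddle :
    inr A B B ≫ insertMiddle A B = inr A B B ≫ inr A B (tensorObj A B B) := by
  ext b
  exact Algebra.TensorProduct.map_tmul _ _ 1 b

end AlgebraMaps

section TensorPresheaf

variable {k : Type} [CommRing k] (V : Type u) [AddCommGroup V] [Module k V]

theorem bc_id {A : CommAlgCat.{u} k} (x : A ⊗[k] V) : bc V (𝟙 A) x = x :=
  LinearMap.rTensor_id_apply V A x

theorem bc_comp {A B C : CommAlgCat.{u} k} (f : A ⟶ B) (g : B ⟶ C) (x : A ⊗[k] V) :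
    bc V (f ≫ g) x = bc V g (bc V f x) :=
  LinearMap.rTensor_comp_apply V g.hom.toLinearMap f.hom.toLinearMap x

/-- The presheaf `A ↦ A ⊗ V` of sets. -/
def tensorPsh : Psh.{u, u} k where
  obj A := A ⊗[k] V
  map f := bc V f
  map_id := bc_id V
  map_comp := bc_comp V

theorem tensorPsh_isSheaf [Module.Flat k V] : (tensorPsh (k := k) V).IsSheaf := by
  intro A B f hf x hx
  have bc_injective : Function.Injective (bc V f) :=
    Module.Flat.rTensor_preserves_injective_linearMap _ (RingHom.FaithfullyFlat.injective hf.1)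
  obtain ⟨_, _, rfl⟩ := exists_algHom_eq f
  have : Module.FaithfullyFlat A B := RingHom.faithfullyFlat_algebraMap_iff.mp hf.1
  have mem_ker : ((inl A B B).hom.toLinearMap - (inr A B B).hom.toLinearMap).rTensor V x = 0 := by
    rw [LinearMap.rTensor_sub]
    exact sub_eq_zero.mpr (hx (inl A B B) (inr A B B) (algHom_comp_inl A B B))
  obtain ⟨y, hy⟩ := (Module.Flat.rTensor_exact V (algHom_exact_inl_sub_inr A B) x).mp mem_ker
  exact ⟨y, hy, fun z hz => bc_injective (hz.trans hy.symm)⟩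

end TensorPresheaf

namespace FinRep

variable {k : Type} [CommRing k] {G : CommAlgCat.{u} k ⥤ GrpCat.{u}} {A : CommAlgCat.{u} k}

theorem ρ_one_apply (V : FinRep G) (x : A ⊗[k] V.V) : V.ρ A 1 x = x := by
  rw [map_one, Module.End.one_apply]

theorem ρ_mul_apply (V : FinRep G) (g h : G.obj A) (x : A ⊗[k] V.V) :
    V.ρ A (g * h) x = V.ρ A g (V.ρ A h x) := by
  rw [map_mul, Module.End.mul_apply]

/-- The presheaf `A ↦ A ⊗ V` with the action of `G` given by a representation `V`. -/
def toGSpace (V : FinRep G) : GSpace.{u, u} G where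
  __ := tensorPsh V.V
  smul g x := V.ρ _ g x
  one_smul := V.ρ_one_apply
  mul_smul := V.ρ_mul_apply
  map_smul f g x := V.natural f g x

theorem Sections.ext_of_locally {V : FinRep G} {P : Torsor G A} {s t : V.Sections P}
    (h : ∀ {B : CommAlgCat.{u} k} {b : A ⟶ B} (p : P.pt b), ∃ (C : CommAlgCat.{u} k) (f : B ⟶ C),
      IsFppf f ∧ s.val (P.map f rfl p) = t.val (P.map f rfl p)) : s = t := by
  refine Sections.ext fun {B b} p => ?_
  obtain ⟨C, f, hf, hst⟩ := h p
  rw [s.val_map, t.val_map] at hst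
  refine (tensorPsh_isSheaf V.V f hf (bc V.V f (t.val p)) fun u v huv => ?_).unique hst rfl
  change bc V.V u (bc V.V f (t.val p)) = bc V.V v (bc V.V f (t.val p))
  rw [← bc_comp, ← bc_comp, huv]

end FinRep

section InducedSections

variable {k : Type} [CommRing k] {G H : CommAlgCat.{u} k ⥤ GrpCat.{u}} {A A' : CommAlgCat.{u} k}
  (i : H ⟶ G) (hG : (grpPsh G).IsSheaf)

namespace Torsor

section Points

variable (P : Torsor H A) {B C : CommAlgCat.{u} k} {b : A ⟶ B} {c : A ⟶ C}

theorem diff_self (p : P.pt b) : P.diff p p = 1 :=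
  P.act_injective p <| by rw [P.act_diff, P.act_one]

theorem diff_mul_diff (p q r : P.pt b) : P.diff p q * P.diff q r = P.diff p r :=
  P.act_injective p <| by rw [P.act_mul, P.act_diff, P.act_diff, P.act_diff]

theorem diff_act (p q : P.pt b) (h : H.obj B) : P.diff p (P.act q h) = P.diff p q * h :=
  P.act_injective p <| by rw [P.act_diff, P.act_mul, P.act_diff]

theorem diff_act_left (p q : P.pt b) (h : H.obj B) : P.diff (P.act p h) q = h⁻¹ * P.diff p q :=
  P.act_injective (P.act p h) <| by
    rw [P.act_diff, ← P.act_mul, mul_inv_cancel_left, P.act_diff]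

theorem diff_map (f : B ⟶ C) (hf : b ≫ f = c) (p q : P.pt b) :
    P.diff (P.map f hf p) (P.map f hf q) = H.map f (P.diff p q) :=
  P.act_injective (P.map f hf p) <| by rw [P.act_diff, ← P.map_act, P.act_diff]

theorem toInduce_map (f : B ⟶ C) (hf : b ≫ f = c) (p : P.pt b) :
    P.toInduce i hG (P.map f hf p) = (P.induce i hG).map f hf (P.toInduce i hG p) := by
  refine IndPt.ext' fun {D d} g hd q => ?_
  change (i.app _ (P.diff (P.map g hd (P.map f hf p)) q))⁻¹ =
    (i.app _ (P.diff (P.map (f ≫ g) _ p) q))⁻¹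
  rw [P.map_comp f g hf hd]

theorem toInduce_act (p : P.pt b) (h : H.obj B) :
    P.toInduce i hG (P.act p h) = (P.induce i hG).act (P.toInduce i hG p) (i.app B h) := by
  refine IndPt.ext' fun {D d} g hd q => ?_
  change (i.app _ (P.diff (P.map g hd (P.act p h)) q))⁻¹ =
    (i.app _ (P.diff (P.map g hd p) q))⁻¹ * G.map g (i.app B h)
  rw [P.map_act, P.diff_act_left, map_mul, mul_inv_rev, map_inv, inv_inv, NatTrans.naturality_apply]

theorem exists_eq_act_toInduce (t : (P.induce i hG).pt b) (p : P.pt b) :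
    ∃ g : G.obj B, t = (P.induce i hG).act (P.toInduce i hG p) g :=
  ⟨_, ((P.induce i hG).act_diff (P.toInduce i hG p) t).symm⟩

end Points

variable {f : A ⟶ A'} {P' : Torsor H A'} {P : Torsor H A} {B : CommAlgCat.{u} k} {b' : A' ⟶ B}
  {b : A ⟶ B}

theorem IsoOver.diff_equiv (e : IsoOver f P' P) (hb : f ≫ b' = b) (p q : P'.pt b') :
    P.diff (e.equiv hb p) (e.equiv hb q) = P'.diff p q :=
  P.act_injective (e.equiv hb p) <| by rw [P.act_diff, ← e.equivariant, P'.act_diff]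

theorem IsoOver.induce_toInduce (e : IsoOver f P' P) (hb : f ≫ b' = b) (p : P'.pt b') :
    (e.induce i hG).equiv hb (P'.toInduce i hG p) = P.toInduce i hG (e.equiv hb p) := by
  refine IndPt.ext' fun {D d} g hd q => ?_
  have hd' : f ≫ b' ≫ g = d := by rw [← hd, ← hb, Category.assoc]
  change (i.app _ (P'.diff (P'.map g rfl p) ((e.equiv hd').symm q)))⁻¹ =
    (i.app _ (P.diff (P.map g hd (e.equiv hb p)) q))⁻¹
  rw [← e.diff_equiv hd', Equiv.apply_symm_apply, e.natural hb hd' g rfl hd]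

end Torsor

theorem QuotStack.mapAlongObj_toSpace_toInduce {X : GSpace.{u, w} H} {Y : GSpace.{u, w'} G}
    (ψ : GSpace.MapAlong i X Y) (hY : Y.toPsh.IsSheaf) (x : QuotStack X) {B : CommAlgCat.{u} k}
    {b : x.ring ⟶ B} (p : x.torsor.pt b) :
    (mapAlongObj i hG ψ hY x).toSpace (x.torsor.toInduce i hG p) = ψ.app (x.toSpace p) := by
  have val_ofPt : (IndPt.ofPt (i := i) p).val (𝟙 B) (Category.comp_id b) p = 1 := by
    change (i.app _ (x.torsor.diff (x.torsor.map (𝟙 B) _ p) p))⁻¹ = 1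
    rw [x.torsor.map_id, x.torsor.diff_self, map_one, inv_one]
  have hspec := (ψ.existsUnique_toSpace hY x (IndPt.ofPt p)).choose_spec.1 (𝟙 B)
    (Category.comp_id b) p
  rwa [Y.map_id, val_ofPt, inv_one, Y.one_smul] at hspec

namespace FinRep

/-- The identity of `V`, as a map of spaces that is equivariant along `i : H ⟶ G`. -/
def resMapAlong (V : FinRep G) : GSpace.MapAlong i ((res i).obj V).toGSpace V.toGSpace where
  app x := x
  natural _ _ := rfl
  equivariant _ _ := rfl

namespace Sections

/-- The object of `[V/G]` defined by an equivariant map from a torsor to `V`. -/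
def toQuotStack {V : FinRep G} {P : Torsor G A} (s : V.Sections P) : QuotStack V.toGSpace where
  ring := A
  torsor := P
  toSpace := s.val
  natural := s.val_map
  equivariant := s.val_act

/-- The section defined by an object of `[V/G]`. -/
def ofQuotStack {V : FinRep G} (x : QuotStack V.toGSpace) : V.Sections x.torsor :=
  ⟨x.toSpace, x.natural, x.equivariant⟩

variable (V : FinRep G) (P : Torsor H A)

/-- Restriction of sections along `P ⟶ P ×^H G`. -/
def restrict : V.Sections (P.induce i hG) →ₗ[A] ((res i).obj V).Sections P where
  toFun t := ⟨fun {B b} p => t.val (P.toInduce i hG p),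
    fun {B C b c} f hf p => by beta_reduce; rw [P.toInduce_map, t.val_map]; rfl,
    fun {B b} p h => by beta_reduce; rw [P.toInduce_act, t.val_act, ← map_inv]; rfl⟩
  map_add' _ _ := rfl
  map_smul' _ _ := rfl

variable {V P}

theorem val_restrict (t : V.Sections (P.induce i hG)) {B : CommAlgCat.{u} k} {b : A ⟶ B}
    (p : P.pt b) : (restrict i hG V P t).val p = t.val (P.toInduce i hG p) := rfl

theorem restrict_injective : Function.Injective (restrict i hG V P) := by
  intro s t hst
  refine ext_of_locally fun {B b} q => ?_
  obtain ⟨C, f, hf, ⟨p⟩⟩ := P.locally_nonempty b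
  refine ⟨C, f, hf, ?_⟩
  obtain ⟨g, hg⟩ := P.exists_eq_act_toInduce i hG ((P.induce i hG).map f rfl q) p
  rw [hg, s.val_act, t.val_act, ← val_restrict, ← val_restrict, hst]

theorem restrict_surjective : Function.Surjective (restrict i hG V P) := by
  intro s
  have hV : V.toGSpace.toPsh.IsSheaf := tensorPsh_isSheaf V.V
  refine ⟨ofQuotStack (QuotStack.mapAlongObj i hG (V.resMapAlong i) hV s.toQuotStack),
    ext fun {B b} p => ?_⟩
  exact QuotStack.mapAlongObj_toSpace_toInduce i hG (V.resMapAlong i) hV s.toQuotStack p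

variable (V P)

/-- The isomorphism `P ×^H V ≅ (P ×^H G) ×^G V`, `[p, v] ↦ [[p, 1], v]`, on sections. -/
def extend : ((res i).obj V).Sections P ≃ₗ[A] V.Sections (P.induce i hG) :=
  (LinearEquiv.ofBijective (restrict i hG V P)
    ⟨restrict_injective i hG, restrict_surjective i hG⟩).symm

variable {V P}

theorem val_extend (s : ((res i).obj V).Sections P) {B : CommAlgCat.{u} k} {b : A ⟶ B}
    (p : P.pt b) : (extend i hG V P s).val (P.toInduce i hG p) = s.val p := by
  rw [← val_restrict]
  exact congrArg (fun r : ((res i).obj V).Sections P => r.val p)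
    (LinearEquiv.apply_ofBijective_symm_apply (restrict i hG V P) s)

theorem extend_unique {s : ((res i).obj V).Sections P} {t : V.Sections (P.induce i hG)}
    (h : ∀ {B : CommAlgCat.{u} k} {b : A ⟶ B} (p : P.pt b),
      t.val (P.toInduce i hG p) = s.val p) : t = extend i hG V P s :=
  restrict_injective i hG (ext fun p => (h p).trans (val_extend i hG s p).symm)

theorem pull_extend {f : A ⟶ A'} {P' : Torsor H A'} (e : Torsor.IsoOver f P' P)
    (s : ((res i).obj V).Sections P) :
    pull (e.induce i hG) (extend i hG V P s) = extend i hG V P' (pull e s) :=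
  extend_unique i hG fun p => by
    rw [val_pull, val_pull, Torsor.IsoOver.induce_toInduce, val_extend]

theorem pushRep_extend {W : FinRep G} (φ : V ⟶ W) (s : ((res i).obj V).Sections P) :
    pushRep φ (extend i hG V P s) = extend i hG W P (pushRep ((res i).map φ) s) :=
  extend_unique i hG fun p => by
    rw [val_pushRep, val_extend]
    rfl

end Sections

end FinRep

end InducedSections

section SectionsOverCovering

variable {k : Type} [CommRing k] {G : CommAlgCat.{u} k ⥤ GrpCat.{u}} {A B C D : CommAlgCat.{u} k}

theorem Torsor.map_diff_map (P : Torsor G A) {b : A ⟶ B} {c : A ⟶ C} {d : A ⟶ D}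
    {E : CommAlgCat.{u} k} {e : A ⟶ E} (u : B ⟶ D) (v : C ⟶ D) (hu : b ≫ u = d) (hv : c ≫ v = d)
    (f : D ⟶ E) (hf : d ≫ f = e) (p : P.pt b) (q : P.pt c) :
    G.map f (P.diff (P.map u hu p) (P.map v hv q)) =
      P.diff (P.map (c := e) (u ≫ f) (by rw [← hf, ← hu, Category.assoc]) p)
        (P.map (v ≫ f) (by rw [← hf, ← hv, Category.assoc]) q) := by
  rw [P.map_comp u f hu hf, P.map_comp v f hv hf, P.diff_map]

namespace FinRep

variable (V : FinRep G)

/-- Base change along `f : B ⟶ C` followed by the action of `g⁻¹`. If `P` is a torsor, this carries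
the value of a section of `P ×^G V` at a point `p` over `B` to its value at the point `f(p) g`
over `C`. -/
def twistedBc (f : B ⟶ C) (g : G.obj C) : B ⊗[k] V.V →ₗ[k] C ⊗[k] V.V :=
  (V.ρ C g⁻¹).restrictScalars k ∘ₗ bc V.V f

theorem twistedBc_apply (f : B ⟶ C) (g : G.obj C) (x : B ⊗[k] V.V) :
    V.twistedBc f g x = V.ρ C g⁻¹ (bc V.V f x) := rfl

theorem twistedBc_one (f : B ⟶ C) (x : B ⊗[k] V.V) : V.twistedBc f 1 x = bc V.V f x := by
  rw [twistedBc_apply, inv_one, ρ_one_apply]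

theorem twistedBc_smul (f : B ⟶ C) (g : G.obj C) (b : B) (x : B ⊗[k] V.V) :
    V.twistedBc f g (b • x) = f.hom b • V.twistedBc f g x := by
  rw [twistedBc_apply, bc_smul, map_smul, twistedBc_apply]

theorem twistedBc_mul (f : B ⟶ C) (g h : G.obj C) (x : B ⊗[k] V.V) :
    V.twistedBc f (g * h) x = V.ρ C h⁻¹ (V.twistedBc f g x) := by
  rw [twistedBc_apply, mul_inv_rev, ρ_mul_apply, twistedBc_apply]

theorem bc_twistedBc (f : B ⟶ C) (g : G.obj C) (f' : C ⟶ D) (x : B ⊗[k] V.V) :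
    bc V.V f' (V.twistedBc f g x) = V.twistedBc (f ≫ f') (G.map f' g) x := by
  rw [twistedBc_apply, V.natural, map_inv, ← bc_comp, twistedBc_apply]

theorem twistedBc_bc (f : B ⟶ C) (f' : C ⟶ D) (g : G.obj D) (x : B ⊗[k] V.V) :
    V.twistedBc f' g (bc V.V f x) = V.twistedBc (f ≫ f') g x := by
  rw [twistedBc_apply, ← bc_comp, twistedBc_apply]

theorem twistedBc_twistedBc (f : B ⟶ C) (g : G.obj C) (f' : C ⟶ D) (g' : G.obj D)
    (x : B ⊗[k] V.V) :
    V.twistedBc f' g' (V.twistedBc f g x) = V.twistedBc (f ≫ f') (G.map f' g * g') x := by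
  rw [twistedBc_mul, ← bc_twistedBc, V.twistedBc_apply f']

namespace Sections

variable {V} {P : Torsor G A} {b : A ⟶ B} {c : A ⟶ C}

theorem val_eq_twistedBc (s : V.Sections P) (f : B ⟶ C) (hf : b ≫ f = c) (p : P.pt b)
    (q : P.pt c) : s.val q = V.twistedBc f (P.diff (P.map f hf p) q) (s.val p) := by
  rw [twistedBc_apply, ← s.val_map f hf, ← s.val_act, P.act_diff]

theorem val_injective (hb : IsFppf b) (p : P.pt b) :
    Function.Injective fun s : V.Sections P => s.val p := by
  intro s t hst
  refine ext_of_locally fun {C c} q => ?_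
  obtain ⟨D, f, g, hfg, hg⟩ := isFppf_pushout hb c
  refine ⟨D, g, hg, ?_⟩
  rw [s.val_eq_twistedBc f hfg p, t.val_eq_twistedBc f hfg p]
  exact congrArg _ hst

theorem existsUnique_val (hb : IsFppf b) (p : P.pt b) {m : B ⊗[k] V.V}
    (hm : ∀ {D : CommAlgCat.{u} k} {d : A ⟶ D} (u v : B ⟶ D) (hu : b ≫ u = d) (hv : b ≫ v = d),
      bc V.V v m = V.twistedBc u (P.diff (P.map u hu p) (P.map v hv p)) m) (q : P.pt c) :
    ∃! y : C ⊗[k] V.V, ∀ {D : CommAlgCat.{u} k} {d : A ⟶ D} (u : B ⟶ D) (f : C ⟶ D)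
      (hu : b ≫ u = d) (hf : c ≫ f = d),
      bc V.V f y = V.twistedBc u (P.diff (P.map u hu p) (P.map f hf q)) m := by
  have hV : V.toGSpace.toPsh.IsSheaf := tensorPsh_isSheaf V.V
  obtain ⟨y, hy, hy'⟩ := hV.descend (B := C)
    (fun {D} f x => ∃ (u : B ⟶ D) (hu : b ≫ u = c ≫ f),
      x = V.twistedBc u (P.diff (P.map u hu p) (P.map f rfl q)) m)
    (by
      rintro D E f g _ ⟨u, hu, rfl⟩
      refine ⟨u ≫ g, by rw [← Category.assoc, hu, Category.assoc], ?_⟩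
      change bc V.V g (V.twistedBc _ _ _) = _
      rw [bc_twistedBc, P.map_diff_map u f hu rfl g (Category.assoc ..)])
    (by
      rintro D f _ _ ⟨u, hu, rfl⟩ ⟨v, hv, rfl⟩
      rw [← P.diff_mul_diff _ (P.map v hv p), twistedBc_mul, ← hm u v hu hv, ← twistedBc_apply])
    (by
      obtain ⟨D, u, f, huf, hf⟩ := isFppf_pushout hb c
      exact ⟨D, f, _, hf, u, huf, rfl⟩)
  refine ⟨y, fun {D d} u f hu hf => ?_, fun z hz => hy' z ?_⟩
  · subst hf
    exact hy f _ ⟨u, hu, rfl⟩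
  · rintro D f _ ⟨u, hu, rfl⟩
    exact hz u f hu rfl

theorem exists_val_eq (hb : IsFppf b) (p : P.pt b) {m : B ⊗[k] V.V}
    (hm : ∀ {D : CommAlgCat.{u} k} {d : A ⟶ D} (u v : B ⟶ D) (hu : b ≫ u = d) (hv : b ≫ v = d),
      bc V.V v m = V.twistedBc u (P.diff (P.map u hu p) (P.map v hv p)) m) :
    ∃ s : V.Sections P, s.val p = m := by
  let val {C : CommAlgCat.{u} k} {c : A ⟶ C} (q : P.pt c) := (existsUnique_val hb p hm q).choose
  have val_spec {C D : CommAlgCat.{u} k} {c : A ⟶ C} {d : A ⟶ D} (q : P.pt c) (u : B ⟶ D)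
      (f : C ⟶ D) (hu : b ≫ u = d) (hf : c ≫ f = d) :
      bc V.V f (val q) = V.twistedBc u (P.diff (P.map u hu p) (P.map f hf q)) m :=
    (existsUnique_val hb p hm q).choose_spec.1 u f hu hf
  have val_unique {C : CommAlgCat.{u} k} {c : A ⟶ C} (q : P.pt c) {y : C ⊗[k] V.V}
      (hy : ∀ {D : CommAlgCat.{u} k} {d : A ⟶ D} (u : B ⟶ D) (f : C ⟶ D) (hu : b ≫ u = d)
        (hf : c ≫ f = d),
        bc V.V f y = V.twistedBc u (P.diff (P.map u hu p) (P.map f hf q)) m) : val q = y :=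
    ((existsUnique_val hb p hm q).choose_spec.2 y hy).symm
  refine ⟨⟨fun q => val q, fun {C D c d} f hf q => val_unique _ fun u g hu hg => ?_,
    fun {C c} q h => val_unique _ fun u f hu hf => ?_⟩, val_unique p hm⟩
  · rw [← bc_comp, val_spec q u (f ≫ g) hu (by rw [← Category.assoc, hf, hg]),
      P.map_comp f g hf hg]
  · rw [V.natural, val_spec q u f hu hf, map_inv, ← twistedBc_mul, ← P.diff_act, P.map_act]

end Sections

end FinRep

end SectionsOverCovering

section Evaluation

variable {k : Type} [CommRing k] {G : CommAlgCat.{u} k ⥤ GrpCat.{u}}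

namespace Torsor

variable {A B : CommAlgCat.{u} k} [Algebra A B] [IsScalarTower k A B] (P : Torsor G A)

/-- The element `g` of `G(B ⊗ B)` with `l(p) g = r(p)`, where `l` and `r` are the two maps from `B`
to `B ⊗ B`: the descent datum of `P` with respect to a point `p` over a covering. -/
def cocycle (p : P.pt (algHom A B)) : G.obj (tensorObj A B B) :=
  P.diff (P.map (inl A B B) rfl p) (P.map (inr A B B) (algHom_comp_inl A B B).symm p)

theorem map_cocycle (p : P.pt (algHom A B)) {D : CommAlgCat.{u} k} {d : A ⟶ D} {u v : B ⟶ D}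
    (t : tensorObj A B B ⟶ D) (hu : inl A B B ≫ t = u) (hv : inr A B B ≫ t = v)
    (hu' : algHom A B ≫ u = d) (hv' : algHom A B ≫ v = d) :
    G.map t (P.cocycle p) = P.diff (P.map u hu' p) (P.map v hv' p) := by
  subst hu hv
  exact P.map_diff_map _ _ rfl _ t (by rw [Category.assoc, hu']) p p

theorem map_insertMiddle_cocycle (p : P.pt (algHom A B)) :
    G.map (insertMiddle A B) (P.cocycle p) = G.map (insertRight A B) (P.cocycle p) *
      G.map (inr A B (tensorObj A B B)) (P.cocycle p) := by
  have hl : algHom A B ≫ inl A B (tensorObj A B B) = algHom A (tensorObj A B (tensorObj A B B)) :=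
    rfl
  have hm : algHom A B ≫ inl A B B ≫ inr A B (tensorObj A B B) =
      algHom A (tensorObj A B (tensorObj A B B)) := by
    rw [← inr_insertRight, ← Category.assoc, ← algHom_comp_inl, Category.assoc, inl_insertRight, hl]
  have hr : algHom A B ≫ inr A B B ≫ inr A B (tensorObj A B B) =
      algHom A (tensorObj A B (tensorObj A B B)) := by
    rw [← inr_insertMiddle, ← Category.assoc, ← algHom_comp_inl, Category.assoc, inl_insertMiddle,
      hl]
  rw [P.map_cocycle p _ (inl_insertMiddle A B) (inr_insertMiddle A B) hl hr,
    P.map_cocycle p _ (inl_insertRight A B) (inr_insertRight A B) hl hm,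
    P.map_cocycle p _ rfl rfl hm hr, P.diff_mul_diff]

end Torsor

namespace FinRep

variable (V : FinRep G)

section Linear

variable {R B C : CommAlgCat.{u} k} [Algebra R B] [IsScalarTower k R B] [Algebra R C]
  [IsScalarTower k R C]

/-- The map `twistedBc` along a morphism of `R`-algebras, as an `R`-linear map. -/
def twistedBcLinear (f : B ⟶ C) (hf : algHom R B ≫ f = algHom R C) (g : G.obj C) :
    B ⊗[k] V.V →ₗ[R] C ⊗[k] V.V where
  toFun := V.twistedBc f g
  map_add' := map_add _
  map_smul' a x := by
    rw [← algebraMap_smul B a x, twistedBc_smul]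
    exact (congr($(hf).hom a • V.twistedBc f g x)).trans (algebraMap_smul C a _)

theorem isBaseChange_twistedBcLinear_one {S : CommAlgCat.{u} k} [Algebra R S] [IsScalarTower k R S]
    [Algebra S C] [IsScalarTower k S C] [IsScalarTower R S C] {φ : B →ₗ[R] C}
    (hφ : IsBaseChange S φ) {f : B ⟶ C} (hf : algHom R B ≫ f = algHom R C)
    (hφf : ∀ x, φ x = f.hom x) : IsBaseChange S (V.twistedBcLinear f hf 1) := by
  have twistedBcLinear_eq :
      V.twistedBcLinear f hf 1 = AlgebraTensorModule.map φ LinearMap.id := by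
    refine LinearMap.ext fun x => (V.twistedBc_one _ x).trans ?_
    induction x with
    | zero => rfl
    | tmul b v => exact congr($((hφf b).symm) ⊗ₜ[k] v)
    | add x y hx hy => rw [map_add, map_add, hx, hy]
  rw [twistedBcLinear_eq]
  exact isBaseChange_tensorProduct_map S hφ

end Linear

variable {A B : CommAlgCat.{u} k} [Algebra A B] [IsScalarTower k A B]

theorem isBaseChange_twistedBcLinear_inr (C : CommAlgCat.{u} k) [Algebra A C]
    [IsScalarTower k A C] :
    IsBaseChange B (V.twistedBcLinear (inr A B C) (algHom_comp_inr A B C) 1) :=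
  V.isBaseChange_twistedBcLinear_one (R := A) (S := B) (B := C) (C := tensorObj A B C)
    (TensorProduct.isBaseChange A C B) (algHom_comp_inr A B C) fun _ => rfl

theorem twistedBc_inl_injective (g : G.obj (tensorObj A B B)) :
    Function.Injective (V.twistedBc (inl A B B) g) := by
  obtain ⟨μ, hμ, -⟩ := exists_tensorObj_desc (𝟙 B) (𝟙 B) (A := A) (B := B) rfl
  refine Function.LeftInverse.injective (g := V.twistedBc μ (G.map μ g)⁻¹) fun x => ?_
  rw [twistedBc_twistedBc, hμ, mul_inv_cancel, twistedBc_one, bc_id]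

theorem exists_twistedBc_inl_eq_iff {g : G.obj (tensorObj A B B)}
    (hg : G.map (insertMiddle A B) g =
      G.map (insertRight A B) g * G.map (inr A B (tensorObj A B B)) g)
    (x : tensorObj A B B ⊗[k] V.V) :
    (∃ m, V.twistedBc (inl A B B) g m = x) ↔ bc V.V (insertMiddle A B) x =
      V.twistedBc (insertRight A B) (G.map (inr A B (tensorObj A B B)) g) x := by
  constructor
  · rintro ⟨m, rfl⟩
    rw [bc_twistedBc, twistedBc_twistedBc, inl_insertMiddle, inl_insertRight, hg]
  · intro hx
    obtain ⟨μ, hμl, hμr⟩ := exists_tensorObj_desc (𝟙 B) (𝟙 B) (A := A) (B := B) rfl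
    obtain ⟨s, hsl, hsr⟩ := exists_tensorObj_desc (inl A B B) (𝟙 (tensorObj A B B)) (A := A) rfl
    have middle_s : insertMiddle A B ≫ s = 𝟙 _ := tensorObj_hom_ext
      (by rw [← Category.assoc, inl_insertMiddle, hsl, Category.comp_id])
      (by rw [← Category.assoc, inr_insertMiddle, Category.assoc, hsr])
    have right_s : insertRight A B ≫ s = μ ≫ inl A B B := tensorObj_hom_ext
      (by rw [← Category.assoc, inl_insertRight, hsl, ← Category.assoc, hμl, Category.id_comp])
      (by rw [← Category.assoc, inr_insertRight, Category.assoc, hsr, ← Category.assoc, hμr,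
        Category.id_comp, Category.comp_id])
    refine ⟨bc V.V μ x, ?_⟩
    have hsx := congrArg (bc V.V s) hx
    rw [← bc_comp, middle_s, bc_id, bc_twistedBc, right_s, ← GrpCat.comp_apply, ← G.map_comp, hsr,
      G.map_id, GrpCat.id_apply] at hsx
    rw [twistedBc_bc, ← hsx]

namespace Sections

variable {V} {P : Torsor G A}

theorem exists_val_eq_iff (hb : IsFppf (algHom A B)) (p : P.pt (algHom A B)) (m : B ⊗[k] V.V) :
    (∃ s : V.Sections P, s.val p = m) ↔
      bc V.V (inr A B B) m = V.twistedBc (inl A B B) (P.cocycle p) m := by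
  constructor
  · rintro ⟨s, rfl⟩
    rw [← s.val_map (inr A B B) (algHom_comp_inl A B B).symm p]
    exact s.val_eq_twistedBc _ _ _ _
  · refine fun hm => exists_val_eq hb p fun u v hu hv => ?_
    obtain ⟨t, rfl, rfl⟩ := exists_tensorObj_desc u v (hu.trans hv.symm)
    rw [bc_comp, hm, bc_twistedBc, P.map_cocycle p t rfl rfl hu hv]

variable (V)

/-- The value of a section at a point, as a linear map. -/
def eval (p : P.pt (algHom A B)) : V.Sections P →ₗ[A] B ⊗[k] V.V where
  toFun s := s.val p
  map_add' _ _ := rfl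
  map_smul' a s := algebraMap_smul B a (s.val p)

theorem isBaseChange_eval (hb : IsFppf (algHom A B)) (p : P.pt (algHom A B)) :
    IsBaseChange B (eval V p) := by
  have : Module.FaithfullyFlat A B := RingHom.faithfullyFlat_algebraMap_iff.mp hb.1
  let δ : B ⊗[k] V.V →ₗ[A] tensorObj A B B ⊗[k] V.V :=
    V.twistedBcLinear (inr A B B) (algHom_comp_inr A B B) 1 -
      V.twistedBcLinear (inl A B B) rfl (P.cocycle p)
  let δ' : tensorObj A B B ⊗[k] V.V →ₗ[B] tensorObj A B (tensorObj A B B) ⊗[k] V.V :=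
    V.twistedBcLinear (insertMiddle A B) (inl_insertMiddle A B) 1 -
      V.twistedBcLinear (insertRight A B) (inl_insertRight A B)
        (G.map (inr A B (tensorObj A B B)) (P.cocycle p))
  have comm_middle (m : B ⊗[k] V.V) :
      V.twistedBc (inr A B (tensorObj A B B)) 1 (V.twistedBc (inr A B B) 1 m) =
        V.twistedBc (insertMiddle A B) 1 (V.twistedBc (inr A B B) 1 m) := by
    rw [twistedBc_twistedBc, twistedBc_twistedBc, inr_insertMiddle, map_one, map_one]
  have comm_right (m : B ⊗[k] V.V) :
      V.twistedBc (inr A B (tensorObj A B B)) 1 (V.twistedBc (inl A B B) (P.cocycle p) m) =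
        V.twistedBc (insertRight A B) (G.map (inr A B (tensorObj A B B)) (P.cocycle p))
          (V.twistedBc (inr A B B) 1 m) := by
    rw [twistedBc_twistedBc, twistedBc_twistedBc, inr_insertRight, map_one, one_mul, mul_one]
  refine IsBaseChange.of_left_exact B (f := eval V p) _ _ _ (g := δ)
    (f' := V.twistedBcLinear (inl A B B) rfl (P.cocycle p)) (g' := δ') ?_ ?_
    (V.isBaseChange_twistedBcLinear_inr B)
    (V.isBaseChange_twistedBcLinear_inr (tensorObj A B B)) (fun m => ?_)
    (val_injective hb p) (fun x => ?_) (V.twistedBc_inl_injective _)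
  · exact LinearMap.ext fun s => (V.twistedBc_one _ _).trans
      ((exists_val_eq_iff hb p _).mp ⟨s, rfl⟩)
  · exact LinearMap.ext fun m => (map_sub _ _ _).trans
      (congrArg₂ (· - ·) (comm_middle m) (comm_right m))
  · refine sub_eq_zero.trans (Iff.trans ?_ (exists_val_eq_iff hb p m).symm)
    exact Eq.congr_left (V.twistedBc_one _ _)
  · refine sub_eq_zero.trans (Iff.trans ?_
      (V.exists_twistedBc_inl_eq_iff (P.map_insertMiddle_cocycle p) x).symm)
    exact Eq.congr_left (V.twistedBc_one _ _)

end Sections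

end FinRep

end Evaluation

section VectorBundle

variable {k : Type} [CommRing k] {G : CommAlgCat.{u} k ⥤ GrpCat.{u}} {A : CommAlgCat.{u} k}

namespace FinRep.Sections

variable (V : FinRep G)

theorem finite_projective (P : Torsor G A) :
    Module.Finite A (V.Sections P) ∧ Module.Projective A (V.Sections P) := by
  obtain ⟨B, b, hb, ⟨p⟩⟩ := P.locally_nonempty (𝟙 A)
  rw [Category.id_comp] at p
  obtain ⟨_, _, rfl⟩ := exists_algHom_eq b
  have : Module.FaithfullyFlat A B := RingHom.faithfullyFlat_algebraMap_iff.mp hb.1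
  exact finite_projective_of_isBaseChange (isBaseChange_eval V hb p)

variable {A' : CommAlgCat.{u} k} [Algebra A A'] [IsScalarTower k A A'] {P : Torsor G A}
  {P' : Torsor G A'} [Module A (V.Sections P')] [IsScalarTower A A' (V.Sections P')]

/-- Restriction of sections along a morphism of torsors, as a linear map. -/
def pullLinear (e : Torsor.IsoOver (algHom A A') P' P) : V.Sections P →ₗ[A] V.Sections P' where
  toFun := pull e
  map_add' _ _ := rfl
  map_smul' a s := algebraMap_smul A' a (pull e s)

theorem isBaseChange_pullLinear (e : Torsor.IsoOver (algHom A A') P' P) :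
    IsBaseChange A' (pullLinear V e) := by
  obtain ⟨B, b, hb, ⟨p⟩⟩ := P.locally_nonempty (𝟙 A)
  rw [Category.id_comp] at p
  obtain ⟨D, f, g, hfg, hg⟩ := isFppf_pushout hb (algHom A A')
  obtain ⟨_, _, hAD⟩ := exists_algHom_eq (algHom A A' ≫ g)
  obtain ⟨_, _, rfl⟩ := exists_algHom_eq b
  obtain ⟨_, _, rfl⟩ := exists_algHom_eq f
  obtain ⟨_, _, rfl⟩ := exists_algHom_eq g
  have : IsScalarTower A A' D := .of_algebraMap_eq fun a => congr($(hAD).hom a)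
  have : IsScalarTower A B D := .of_algebraMap_eq fun a => congr($(hAD.trans hfg.symm).hom a)
  have : Module.FaithfullyFlat A' D := RingHom.faithfullyFlat_algebraMap_iff.mp hg.1
  let p' : P'.pt (algHom A' D) := (e.equiv rfl).symm (P.map (algHom B D) hfg p)
  have eval_pull : (eval V p').restrictScalars A ∘ₗ pullLinear V e =
      (V.twistedBcLinear (R := B) (algHom B D) rfl 1).restrictScalars A ∘ₗ eval V p := by
    refine LinearMap.ext fun s => ?_
    change s.val (e.equiv rfl p') = V.twistedBc (algHom B D) 1 (s.val p)
    rw [Equiv.apply_symm_apply, s.val_map, twistedBc_one]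
  refine isBaseChange_of_comp_faithfullyFlat (isBaseChange_eval V hg p') ?_
  rw [eval_pull]
  exact (isBaseChange_eval V hb p).comp
    (V.isBaseChange_twistedBcLinear_one (IsBaseChange.linearMap B D) _ fun _ => rfl)

end FinRep.Sections

theorem isVectorBundle_tilde (X : GSpace.{u, w} G) (V : FinRep G) :
    IsVectorBundle ((FinRep.tilde X).obj V) := by
  refine ⟨fun x => (FinRep.Sections.finite_projective V x.unop.torsor).1,
    fun x => (FinRep.Sections.finite_projective V x.unop.torsor).2, fun {x y} α => ?_⟩
  let f : x.unop.ring ⟶ y.unop.ring := QuotStack.Hom.base α.unop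
  let _ : Algebra x.unop.ring y.unop.ring := f.hom.toRingHom.toAlgebra
  have : IsScalarTower k x.unop.ring y.unop.ring :=
    .of_algebraMap_eq fun a => (f.hom.commutes a).symm
  let _ : Module x.unop.ring (V.Sections y.unop.torsor) := Module.compHom _ f.hom.toRingHom
  have : IsScalarTower x.unop.ring y.unop.ring (V.Sections y.unop.torsor) :=
    ⟨fun _ b s => mul_smul _ b s⟩
  exact FinRep.Sections.isBaseChange_pullLinear V (QuotStack.Hom.iso α.unop)

end VectorBundle

section PullbackAlong

variable {k : Type} [CommRing k] {G H : CommAlgCat.{u} k ⥤ GrpCat.{u}} (i : H ⟶ G)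
  (hG : (grpPsh G).IsSheaf) {X : GSpace.{u, w} H} {Y : GSpace.{u, w'} G}
  (ψ : GSpace.MapAlong i X Y) (hY : Y.toPsh.IsSheaf)

/-- An isomorphism between the vector bundles on `[X/H]` defined by the restrictions to `H` of
representations of `G` and the pullbacks of the vector bundles that they define on `[Y/G]` is
canonical if, at every object `(P, φ)` of `[X/H]`, it sends a section `[p, s(p)]` of `P ×^H V` to
the section `[[p, 1], s(p)]` of `(P ×^H G) ×^G V`. -/
def IsCanonicalAlong
    (θ : FinRep.res i ⋙ FinRep.tilde X ≅
      FinRep.tilde Y ⋙ QuotStack.pullbackAlong i hG ψ hY) : Prop :=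
  ∀ (V : FinRep G) (x : QuotStack X) (s : ((FinRep.res i).obj V).Sections x.torsor)
    {B : CommAlgCat.{u} k} {b : x.ring ⟶ B} (p : x.torsor.pt b),
    FinRep.Sections.val (V := V) (P := x.torsor.induce i hG)
      ((θ.hom.app V).app (Opposite.op x) s) (x.torsor.toInduce i hG p) = s.val p

/-- The canonical isomorphism between the vector bundles on `[X/H]` defined by the restrictions to
`H` of representations of `G` and the pullbacks of the vector bundles that they define on
`[Y/G]`. -/
def canonicalIso : FinRep.res i ⋙ FinRep.tilde X ≅
    FinRep.tilde Y ⋙ QuotStack.pullbackAlong i hG ψ hY :=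
  NatIso.ofComponents
    (fun V => PresheafOfModules.isoMk
      (fun x => LinearEquiv.toModuleIso (R := x.unop.ring)
        (FinRep.Sections.extend i hG V x.unop.torsor))
      (by
        intro x y α
        ext s
        exact (FinRep.Sections.pull_extend i hG (QuotStack.Hom.iso α.unop) s).symm))
    (fun φ => by
      ext x s
      exact (FinRep.Sections.pushRep_extend i hG (P := x.unop.torsor) φ s).symm)

theorem isCanonicalAlong_canonicalIso : IsCanonicalAlong i hG ψ hY (canonicalIso i hG ψ hY) :=
  fun _ _ s _ _ p => FinRep.Sections.val_extend i hG s p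

variable {i hG ψ hY} in
theorem IsCanonicalAlong.eq_canonicalIso
    {θ : FinRep.res i ⋙ FinRep.tilde X ≅ FinRep.tilde Y ⋙ QuotStack.pullbackAlong i hG ψ hY}
    (hθ : IsCanonicalAlong i hG ψ hY θ) : θ = canonicalIso i hG ψ hY := by
  ext V x s
  exact FinRep.Sections.extend_unique i hG (P := x.unop.torsor) fun p => hθ V x.unop s p

end PullbackAlong

end LanglandsParameters

end

open LanglandsParameters in
theorem mainTheorem6_general {k : Type} [CommRing k] {G H : CommAlgCat.{u} k ⥤ GrpCat.{u}}
    (i : H ⟶ G) (hG : (grpPsh G).IsSheaf) {X : GSpace.{u, w} H} {Y : GSpace.{u, w'} G}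
    (ψ : GSpace.MapAlong i X Y) (hY : Y.toPsh.IsSheaf) :
    (∀ V : FinRep G, IsVectorBundle ((FinRep.tilde Y).obj V) ∧
      IsVectorBundle ((FinRep.res i ⋙ FinRep.tilde X).obj V)) ∧
    ∃! θ : FinRep.res i ⋙ FinRep.tilde X ≅ FinRep.tilde Y ⋙ QuotStack.pullbackAlong i hG ψ hY,
      IsCanonicalAlong i hG ψ hY θ :=
  ⟨fun V => ⟨isVectorBundle_tilde Y V, isVectorBundle_tilde X ((FinRep.res i).obj V)⟩,
    canonicalIso i hG ψ hY, isCanonicalAlong_canonicalIso i hG ψ hY, fun _ hθ => hθ.eq_canonicalIso⟩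

theorem mainTheorem6 {F : Type w} [Field F] [ValuativeRel F] [TopologicalSpace F]
    [IsNonarchimedeanLocalField F]
    (Ft : IntermediateField F (AlgebraicClosure F)) [FiniteDimensional F Ft] [IsGalois F Ft]
    (D : LanglandsParameters.CGroupDatum.{u} Ft) (c : LanglandsParameters.TameChoice F) :
    (∀ V : LanglandsParameters.FinRep D.grp,
      LanglandsParameters.IsVectorBundle
        ((LanglandsParameters.FinRep.tilde (D.locSpace c)).obj V) ∧
      LanglandsParameters.IsVectorBundle ((D.sphBundle c).obj V)) ∧
    ∃! θ : D.sphBundle c ≅ D.locBundle c, D.IsCanonical c θ :=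
  mainTheorem6_general D.incl D.isSheaf (D.sphToLoc c) (D.locSpace_isSheaf c)
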